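/- **Notation.** $(a;q)_n=\prod_{i=0}^{n-1}(1-aq^i)$ and $\left[\begin{matrix} n\\ m\end{matrix}\right]_q=(q^{n-m+1};q)_m/(q;q)_m$ for integers $n$ and $m\ge 0$; $q$ is a formal variable and the identities hold in the field $\mathbb{Q}((q))$ of formal Laurent series. For integers $n\ge k\ge 0$: - $L_{n,k}$ is the set of partitions $\lambda=(\lambda_1\ge\dots\ge\lambda_k\ge 0)$ with $\frac{\lambda_1}{n}\ge\frac{\lambda_2}{n-1}\ge\dots\ge\frac{\lambda_k}{n-k+1}\ge 0$, and $\bar L_{n,k}$ is the set of those $\lambda\in L_{n,k}$ all of whose $k$ parts are positive; - $R_{n,k}$ is the set of partitions into odd parts less than $2n$ in which at most $\lfloor k/2\rfloor$ parts, counted with multiplicity (as everywhere below), lie in $\{2\lceil k/2\rceil+1,2\lceil k/2\rceil+3,\dots,2(n-\lfloor k/2\rfloor)-1\}$; - $L_{n,k}(q)$, $\bar L_{n,k}(q)$, $R_{n,k}(q)$ are the generating functions $\sum q^{|\lambda|}$ of these sets. **Finitization 1.** For $n\ge k\ge 0$, $$L_{n,k}(q)=\sum_{m=0}^k q^{\binom{m+1}{2}}\left[\begin{matrix}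 n\\ m\end{matrix}\right]_q\frac{(-q^{n-m+1};q)_m}{(q^{2n-m+1};q)_m}=\sum_{i=0}^{\lfloor k/2\rfloor}\frac{q^{i(2\lceil k/2\rceil+1)}\left[\begin{matrix} n-k-1+i\\ i\end{matrix}\right]_{q^2}}{(q;q^2)_{\lceil k/2\rceil}(q^{2n-1};q^{-2})_{\lfloor k/2\rfloor}}=R_{n,k}(q);$$ in particular, for every $N\ge0$, the number of partitions of $N$ in $L_{n,k}$ equals the number of partitions of $N$ in $R_{n,k}$. For fixed $k$, as $n\to\infty$, each coefficient of the two middle expressions is eventually equal to the corresponding coefficient of the respective side of $$\sum_{m=0}^k\frac{q^{\binom{m+1}{2}}}{(q;q)_m}=\sum_{i=0}^{\lfloor k/2\rfloor}\frac{q^{i(2\lceil k/2\rceil+1)}}{(q;q^2)_{\lceil k/2\rceil}(q^2;q^2)_i},$$ and this identity holds. **Refinement 1.** For all $k,N\ge0$, the number of partitions of $N$ into at most $k$ distinct parts equals the number of partitions of $N$ into odd parts such that at most $\lfloor k/2\rfloor$ of the parts are greater than or equal to $2\lceil k/2\rceil+1$. **Finitization 2.** For $n\ge k\ge 0$, $$\bar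 L_{n,k}(q)=q^{\binom{k+1}{2}}\left[\begin{matrix} n\\ k\end{matrix}\right]_q\frac{(-q^{n-k+1};q)_k}{(q^{2n-k+1};q)_k}=\frac{q^{\binom{k+1}{2}}\left[\begin{matrix} n-\lceil k/2\rceil\\ \lfloor k/2\rfloor\end{matrix}\right]_{q^2}}{(q;q^2)_{\lceil k/2\rceil}(q^{2n-1};q^{-2})_{\lfloor k/2\rfloor}}.$$ Moreover, for every $N\ge0$, the number of partitions of $N$ in $\bar L_{n,k}$ equals the number of partitions of $N-(\lceil k/2\rceil-\lfloor k/2\rfloor)$ into odd parts less than $2n$ with at least $\lfloor k/2\rfloor$ parts in $\{2\lceil k/2\rceil+1,\dots,2n-2\lfloor k/2\rfloor+1\}$, but at most $\lfloor k/2\rfloor$ parts in this set that are less than $2n-2\lfloor k/2\rfloor+1$. For fixed $k$, as $n\to\infty$, each coefficient of the two explicit expressions is eventually equal to the corresponding coefficient of the respective side of $$\frac{q^{\binom{k+1}{2}}}{(q;q)_k}=\frac{q^{\binom{k+1}{2}}}{(q;q^2)_{\lceil k/2\rceil}(q^2;q^2)_{\lfloor k/2\rfloor}},$$ and this identity holds.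 **Refinement 2.** For all $k,N\ge0$, the number of partitions of $N$ into exactly $k$ distinct parts equals the number of partitions of $N-(\lceil k/2\rceil-\lfloor k/2\rfloor)$ into odd parts such that exactly $\lfloor k/2\rfloor$ of the parts are greater than or equal to $2\lceil k/2\rceil+1$. (A negative integer has no partitions.) -/

import Mathlib

namespace LectureHall

/-- The `q`-shifted factorial `(a; q)_n = ∏_{i=0}^{n-1} (1 - a q^i)`. -/
def qPoch {K : Type*} [Field K] (a q : K) (n : ℕ) : K :=
  ∏ i ∈ Finset.range n, (1 - a * q ^ i)

/-- The Gaussian polynomial `[n, m]_q = (q^{n-m+1}; q)_m / (q; q)_m`. The upper entry is an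
integer, so that `[-1, 0]_q = 1` needs no convention. -/
def gauss {K : Type*} [Field K] (q : K) (n : ℤ) (m : ℕ) : K :=
  qPoch (q ^ (n - m + 1)) q m / qPoch q q m

/-- The formal variable `q` of the field `ℚ((q))` of formal Laurent series. -/
noncomputable def qvar : LaurentSeries ℚ := HahnSeries.single 1 1

/-- The generating function `∑_N c(N) q^N`. -/
noncomputable def genFun (c : ℕ → ℕ) : LaurentSeries ℚ :=
  HahnSeries.ofPowerSeries ℤ ℚ (PowerSeries.mk fun N => (c N : ℚ))

/-- `q^{m+1 choose 2} [n, m]_q (-q^{n-m+1}; q)_m / (q^{2n-m+1}; q)_m`. -/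
noncomputable def hallTerm {K : Type*} [Field K] (q : K) (n m : ℕ) : K :=
  q ^ (m + 1).choose 2 * gauss q n m *
    (qPoch (-q ^ ((n : ℤ) - m + 1)) q m / qPoch (q ^ (2 * (n : ℤ) - m + 1)) q m)

/-- Here and below, `(k + 1) / 2 = ⌈k/2⌉` and `k / 2 = ⌊k/2⌋`. This is
`∑_{i=0}^{⌊k/2⌋} q^{i(2⌈k/2⌉+1)} [n-k-1+i, i]_{q²} / ((q; q²)_{⌈k/2⌉} (q^{2n-1}; q⁻²)_{⌊k/2⌋})`. -/
noncomputable def oddSum {K : Type*} [Field K] (q : K) (n k : ℕ) : K :=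
  ∑ i ∈ Finset.range (k / 2 + 1),
    q ^ (i * (2 * ((k + 1) / 2) + 1)) * gauss (q ^ 2) ((n : ℤ) - k - 1 + i) i /
      (qPoch q (q ^ 2) ((k + 1) / 2) * qPoch (q ^ (2 * (n : ℤ) - 1)) (q ^ (-2 : ℤ)) (k / 2))

/-- `q^{k+1 choose 2} [n-⌈k/2⌉, ⌊k/2⌋]_{q²} / ((q; q²)_{⌈k/2⌉} (q^{2n-1}; q⁻²)_{⌊k/2⌋})`. -/
noncomputable def oddTerm {K : Type*} [Field K] (q : K) (n k : ℕ) : K :=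
  q ^ (k + 1).choose 2 * gauss (q ^ 2) ((n : ℤ) - ((k + 1) / 2 : ℕ)) (k / 2) /
    (qPoch q (q ^ 2) ((k + 1) / 2) * qPoch (q ^ (2 * (n : ℤ) - 1)) (q ^ (-2 : ℤ)) (k / 2))

open Classical in
/-- The number of partitions of the integer `N` whose multiset of (positive) parts satisfies `P`;
a negative integer has no partitions. -/
noncomputable def numPartitions (P : Multiset ℕ → Prop) (N : ℤ) : ℕ :=
  if 0 ≤ N then (Finset.univ.filter fun p : N.toNat.Partition => P p.parts).card else 0

/-- `L_{n,k}`: the partitions `(λ_1, …, λ_k)` into `k` nonnegative parts with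
`λ_1/n ≥ λ_2/(n-1) ≥ … ≥ λ_k/(n-k+1) ≥ 0`; the index `i : Fin k` stands for `i + 1`. -/
def truncatedHall (n k : ℕ) : Set (Fin k → ℕ) :=
  {l | Antitone l ∧ Antitone fun i : Fin k => (l i : ℚ) / ((n : ℚ) - (i : ℕ))}

/-- The set of the elements of `L_{n,k}` with `k` positive parts. -/
def positiveHall (n k : ℕ) : Set (Fin k → ℕ) :=
  {l | l ∈ truncatedHall n k ∧ ∀ i, 0 < l i}

/-- The number of sequences of weight `N` in a set of sequences of length `k`
(there are only finitely many sequences of weight `N`). -/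
noncomputable def numOfWeight {k : ℕ} (S : Set (Fin k → ℕ)) (N : ℕ) : ℕ :=
  {l | l ∈ S ∧ ∑ i, l i = N}.ncard

/-- `R_{n,k}`: odd parts less than `2n`, at most `⌊k/2⌋` of which (with multiplicity) are in
`{2⌈k/2⌉+1, 2⌈k/2⌉+3, …, 2(n-⌊k/2⌋)-1}`. -/
def InR (n k : ℕ) (s : Multiset ℕ) : Prop :=
  (∀ i ∈ s, Odd i ∧ i < 2 * n) ∧
    s.countP (fun i => 2 * ((k + 1) / 2) + 1 ≤ i ∧ i ≤ 2 * (n - k / 2) - 1) ≤ k / 2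

/-- Odd parts less than `2n`, at least `⌊k/2⌋` of which are in
`{2⌈k/2⌉+1, …, 2n-2⌊k/2⌋+1}`, but at most `⌊k/2⌋` of which are in this set and
less than `2n-2⌊k/2⌋+1`. -/
def InRPos (n k : ℕ) (s : Multiset ℕ) : Prop :=
  (∀ i ∈ s, Odd i ∧ i < 2 * n) ∧
    k / 2 ≤ s.countP (fun i => 2 * ((k + 1) / 2) + 1 ≤ i ∧ i ≤ 2 * n - 2 * (k / 2) + 1) ∧
    s.countP (fun i => 2 * ((k + 1) / 2) + 1 ≤ i ∧ i < 2 * n - 2 * (k / 2) + 1) ≤ k / 2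

end LectureHall

open LectureHall

/-!
The two finite identities are proved by comparing generating functions in `ℚ((q))` with the
explicit expressions, and the statements about partitions are read off from the coefficients.

**Lecture hall side.** Let `λ` be a lecture hall partition with `k` positive parts in which exactly
`j` parts satisfy `λ_i > n - i + 1`. These are the first `j` parts; subtracting `n - i + 1` from
each of them leaves an arbitrary lecture hall partition with `j` positive parts, and the other
`k - j` parts form an arbitrary strictly decreasing sequence in `{1, …, n - j}`
(`bijOn_hallSet`). For fixed `n` this gives a recursion in `k` for the generating functions
(`gf_hallSet_rec`) which determines them. The terms `hallTerm q n k` satisfy the same recursion: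
after cancelling the common factors it is the `q`-Chu–Vandermonde summation with base `q⁻¹`
(`sum_gauss_chu_vandermonde`, `hallTerm_rec`). Sorting the elements of `L_{n,k}` by their number of
positive parts gives the sum over `m ≤ k`.

**Odd side.** The generating function of the multisets of `i` elements of
`{d, d + 2, …, d + 2(m - 1)}` is `q^{di} [m - 1 + i, i]_{q²}` (`progTerm`), by adjoining one letter
at a time; letters that may be used freely contribute the factors of `oddDenom`. This evaluates
`R_{n,k}` (`genFun_inR`). The set `InRPos n k` is a difference of two sets of this kind
(`genFun_inRPos`).

**Comparison.** Splitting all products into even and odd exponents gives `hallTerm = oddTerm`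
(`hallTerm_eq_oddTerm`), and the two `q`-Pascal rules give
`oddSum (k + 1) = oddSum k + oddTerm (k + 1)` (`oddSum_succ`), the parity of `k` deciding which of
the two is used.

**Limits.** In the `q`-adic topology of `ℚ((q))` one has `q ^ n → 0`, and convergence implies that
each coefficient is eventually constant (`eventually_coeff_eq`). For `n` large compared with `N` and
`k`, the upper bounds on the odd parts are no restriction on partitions of `N`; comparing with the
generating functions of partitions into distinct parts yields the refinements of Euler's theorem.
-/

namespace LectureHall

/-! ### Shifted factorials and Gaussian polynomials -/

section Algebra

variable {K : Type*} [Field K]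

@[simp]
lemma qPoch_zero (a q : K) : qPoch a q 0 = 1 := by simp [qPoch]

lemma qPoch_succ (a q : K) (n : ℕ) :
    qPoch a q (n + 1) = qPoch a q n * (1 - a * q ^ n) := by
  simp [qPoch, Finset.prod_range_succ]

lemma qPoch_succ' (a q : K) (n : ℕ) :
    qPoch a q (n + 1) = (1 - a) * qPoch (a * q) q n := by
  rw [qPoch, Finset.prod_range_succ', qPoch, mul_comm]
  simp [pow_succ', mul_assoc]

lemma qPoch_ne_zero {a q : K} {n : ℕ} (h : ∀ i < n, a * q ^ i ≠ 1) : qPoch a q n ≠ 0 :=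
  Finset.prod_ne_zero_iff.2 fun i hi => sub_ne_zero.2 (h i (Finset.mem_range.1 hi)).symm

/-- Nonzero elements that are not roots of unity; for these the denominators `(q; q)_m` do not
vanish and negative powers make sense. -/
structure Nontorsion (q : K) : Prop where
  ne_zero : q ≠ 0
  pow_ne_one : ∀ n : ℕ, 0 < n → q ^ n ≠ 1

namespace Nontorsion

variable {q : K}

lemma zpow_ne_one (hq : Nontorsion q) {z : ℤ} (hz : z ≠ 0) : q ^ z ≠ 1 := by
  obtain ⟨n, rfl | rfl⟩ := z.eq_nat_or_neg
  · simpa using hq.pow_ne_one n (by omega)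
  · simpa using hq.pow_ne_one n (by omega)

lemma inv (hq : Nontorsion q) : Nontorsion q⁻¹ :=
  ⟨inv_ne_zero hq.ne_zero, fun n hn => by simpa using hq.pow_ne_one n hn⟩

lemma pow (hq : Nontorsion q) {m : ℕ} (hm : 0 < m) : Nontorsion (q ^ m) :=
  ⟨pow_ne_zero _ hq.ne_zero, fun n hn => by
    rw [← pow_mul]; exact hq.pow_ne_one _ (Nat.mul_pos hm hn)⟩

lemma one_sub_pow_ne_zero (hq : Nontorsion q) (n : ℕ) : 1 - q ^ (n + 1) ≠ 0 :=
  sub_ne_zero.2 (hq.pow_ne_one _ n.succ_pos).symm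

lemma qPoch_self_ne_zero (hq : Nontorsion q) (n : ℕ) : qPoch q q n ≠ 0 :=
  qPoch_ne_zero fun i _ => by rw [← pow_succ']; exact hq.pow_ne_one _ i.succ_pos

end Nontorsion

@[simp]
lemma gauss_zero_right (q : K) (n : ℤ) : gauss q n 0 = 1 := by simp [gauss]

lemma gauss_succ_right {q : K} (hq : Nontorsion q) (n : ℤ) (m : ℕ) :
    gauss q n (m + 1) * (1 - q ^ (m + 1)) = gauss q n m * (1 - q ^ (n - m)) := by
  have h1 := hq.qPoch_self_ne_zero m
  have h2 := hq.one_sub_pow_ne_zero m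
  rw [gauss, gauss, qPoch_succ q q m, qPoch_succ', ← zpow_add_one₀ hq.ne_zero, ← pow_succ']
  have : n - (m + 1 : ℕ) + 1 = n - m := by push_cast; ring
  rw [this]
  field_simp

lemma gauss_succ_left {q : K} (hq : Nontorsion q) (n : ℤ) (m : ℕ) :
    gauss q (n + 1) m * (1 - q ^ (n + 1 - m)) = gauss q n m * (1 - q ^ (n + 1)) := by
  have h1 := hq.qPoch_self_ne_zero m
  have h := (qPoch_succ (q ^ (n - m + 1)) q m).symm.trans (qPoch_succ' _ _ _)
  rw [← zpow_add_one₀ hq.ne_zero, ← zpow_natCast, ← zpow_add₀ hq.ne_zero] at h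
  rw [gauss, gauss, show n + 1 - m = n - m + 1 by ring]
  rw [show n - m + 1 + (m : ℤ) = n + 1 by ring] at h
  rw [div_mul_eq_mul_div, div_mul_eq_mul_div, h, mul_comm]

@[simp]
lemma gauss_self {q : K} (hq : Nontorsion q) (m : ℕ) : gauss q m m = 1 := by
  simp [gauss, div_self (hq.qPoch_self_ne_zero m)]

lemma gauss_succ_self {q : K} (hq : Nontorsion q) (m : ℕ) : gauss q m (m + 1) = 0 := by
  have := gauss_succ_right hq m m
  simpa [hq.one_sub_pow_ne_zero m] using this

lemma gauss_neg_one_succ {q : K} (hq : Nontorsion q) (m : ℕ) :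
    gauss q (-1 + (m + 1 : ℕ)) (m + 1) = 0 := by
  simpa using gauss_succ_self hq m

/-- `q`-Pascal rule, by the largest part. -/
lemma gauss_pascal {q : K} (hq : Nontorsion q) (n : ℤ) (m : ℕ) :
    gauss q (n + 1) (m + 1) = gauss q n (m + 1) + q ^ (n - m) * gauss q n m := by
  have h2 := hq.one_sub_pow_ne_zero m
  have h0 := hq.ne_zero
  have e1 := gauss_succ_right hq n m
  have e2 := gauss_succ_right hq (n + 1) m
  have e3 := gauss_succ_left hq n m
  apply mul_right_cancel₀ h2
  rw [add_mul, e2, e1, e3]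
  have : q ^ (n + 1) = q ^ (n - m) * q ^ (m + 1) := by
    rw [← zpow_natCast q (m + 1), ← zpow_add₀ h0]; congr 1; push_cast; ring
  rw [this]; ring

/-- `q`-Pascal rule, by the number of parts. -/
lemma gauss_pascal' {q : K} (hq : Nontorsion q) (n : ℤ) (m : ℕ) :
    gauss q (n + 1) (m + 1) = q ^ (m + 1) * gauss q n (m + 1) + gauss q n m := by
  have h2 := hq.one_sub_pow_ne_zero m
  have h0 := hq.ne_zero
  have e1 := gauss_succ_right hq n m
  have e2 := gauss_succ_right hq (n + 1) m
  have e3 := gauss_succ_left hq n m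
  apply mul_right_cancel₀ h2
  rw [add_mul, mul_assoc, e2, e1, e3]
  have : q ^ (n + 1) = q ^ (n - m) * q ^ (m + 1) := by
    rw [← zpow_natCast q (m + 1), ← zpow_add₀ h0]; congr 1; push_cast; ring
  rw [this]; ring

lemma gauss_mul_gauss {q : K} (hq : Nontorsion q) (n : ℤ) (j r : ℕ) :
    gauss q n j * gauss q (n - j) r = gauss q n (j + r) * gauss q ((j + r : ℕ) : ℤ) j := by
  induction r with
  | zero => simp [gauss_self hq]
  | succ r ih =>
    have e1 := gauss_succ_right hq (n - j) r
    have e2 := gauss_succ_right hq n (j + r)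
    have e3 := gauss_succ_left hq ((j + r : ℕ) : ℤ) j
    have h1 := hq.one_sub_pow_ne_zero r
    have h2 := hq.one_sub_pow_ne_zero (j + r)
    have z1 : q ^ (((j + r : ℕ) : ℤ) + 1 - j) = q ^ (r + 1) := by
      rw [← zpow_natCast q (r + 1)]; congr 1; push_cast; ring
    have z2 : q ^ (((j + r : ℕ) : ℤ) + 1) = q ^ (j + r + 1) := by
      rw [← zpow_natCast q (j + r + 1)]; congr 1
    have z3 : n - j - r = n - (j + r : ℕ) := by push_cast; ring
    rw [z1, z2] at e3
    rw [z3] at e1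
    rw [← add_assoc, Nat.cast_succ]
    apply mul_right_cancel₀ h1
    apply mul_right_cancel₀ h2
    linear_combination (gauss q n j * (1 - q ^ (j + r + 1))) * e1
      - (gauss q (((j + r : ℕ) : ℤ) + 1) j * (1 - q ^ (r + 1))) * e2
      - (gauss q n (j + r) * (1 - q ^ (n - (j + r : ℕ)))) * e3
      + ((1 - q ^ (n - (j + r : ℕ))) * (1 - q ^ (j + r + 1))) * ih

/-- Gaussian polynomials are palindromic. -/
lemma gauss_inv {q : K} (hq : Nontorsion q) (n : ℤ) (m : ℕ) :
    gauss q n m = q ^ (m * (n - m)) * gauss q⁻¹ n m := by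
  induction m with
  | zero => simp
  | succ m ih =>
    have e1 := gauss_succ_right hq n m
    have e2 := gauss_succ_right hq.inv n m
    have h1 := hq.one_sub_pow_ne_zero m
    have h0 := hq.ne_zero
    have h2 : q ^ (n - m) ≠ 0 := zpow_ne_zero _ h0
    apply mul_right_cancel₀ h1
    rw [e1, ih]
    have z : q ^ (((m + 1 : ℕ) : ℤ) * (n - (m + 1 : ℕ))) * q ^ (m + 1) =
        q ^ (m * (n - m)) * q ^ (n - m) := by
      rw [← zpow_natCast q (m + 1), ← zpow_add₀ h0, ← zpow_add₀ h0]
      congr 1; push_cast; ring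
    have e3 : 1 - q ^ (m + 1) = -q ^ (m + 1) * (1 - q⁻¹ ^ (m + 1)) := by
      rw [inv_pow]; field_simp; ring
    have e4 : 1 - q ^ (n - m) = -q ^ (n - m) * (1 - q⁻¹ ^ (n - m)) := by
      rw [inv_zpow]; field_simp; ring
    rw [e3, e4]
    linear_combination (-(q ^ (m * (n - m)) * q ^ (n - m))) * e2.symm +
      (gauss q⁻¹ n (m + 1) * (1 - q⁻¹ ^ (m + 1))) * z

/-- The `q`-Chu–Vandermonde summation. One step of the induction passes from `a` to `a p`. -/
lemma sum_gauss_chu_vandermonde {p : K} (hp : Nontorsion p) (k : ℕ) (a b : K)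
    (h : ∀ i < k, a * b * p ^ i ≠ 1) :
    ∑ j ∈ Finset.range (k + 1), gauss p k j * p ^ j.choose 2 * (-a) ^ j *
      (qPoch b p j / qPoch (a * b) p j) = qPoch a p k / qPoch (a * b) p k := by
  induction k generalizing a with
  | zero => simp
  | succ k ih =>
    have h0 : 1 - a * b ≠ 0 := sub_ne_zero.2 (by simpa using (h 0 (by omega)).symm)
    have hshift : ∀ i < k, a * p * b * p ^ i ≠ 1 := fun i hi => by
      have := h (i + 1) (by omega)
      rwa [pow_succ', ← mul_assoc, mul_right_comm a b p] at this
    have key := ih (a * p) hshift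
    set A : ℕ → K := fun j => p ^ j.choose 2 * (-a) ^ j * (qPoch b p j / qPoch (a * b) p j) with hA
    have hsplit : ∑ j ∈ Finset.range (k + 1 + 1), gauss p (k + 1 : ℕ) j * A j =
        ∑ j ∈ Finset.range (k + 1), gauss p k j * (p ^ j * A j + A (j + 1)) := by
      have e1 : ∑ j ∈ Finset.range (k + 1 + 1), p ^ j * (gauss p k j * A j) =
          ∑ j ∈ Finset.range (k + 1), p ^ j * (gauss p k j * A j) := by
        rw [Finset.sum_range_succ, gauss_succ_self hp]; simp
      rw [Finset.sum_range_succ']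
      simp only [Nat.cast_succ, gauss_pascal' hp, add_mul, Finset.sum_add_distrib, mul_add]
      rw [Finset.sum_range_succ'] at e1
      simp only [pow_zero, gauss_zero_right, one_mul] at e1 ⊢
      have e2 : ∀ j, p ^ j * (gauss p k j * A j) = gauss p k j * (p ^ j * A j) := fun j => by ring
      simp only [← e2]
      rw [← e1]
      simp only [mul_assoc]
      ring
    have hterm : ∀ j ∈ Finset.range (k + 1), gauss p k j * (p ^ j * A j + A (j + 1)) =
        (1 - a) / (1 - a * b) * (gauss p k j * p ^ j.choose 2 * (-(a * p)) ^ j *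
          (qPoch b p j / qPoch (a * p * b) p j)) := by
      intro j hj
      have hj' : j < k + 1 := Finset.mem_range.1 hj
      have n1 : qPoch (a * b) p j ≠ 0 := qPoch_ne_zero fun i hi => h i (by omega)
      have n2 : 1 - a * b * p ^ j ≠ 0 := sub_ne_zero.2 (h j hj').symm
      have n3 : qPoch (a * p * b) p j ≠ 0 := qPoch_ne_zero fun i hi => hshift i (by omega)
      have e := (qPoch_succ (a * b) p j).symm.trans (qPoch_succ' _ _ _)
      rw [mul_right_comm a b p] at e
      have e' : qPoch (a * p * b) p j = qPoch (a * b) p j * (1 - a * b * p ^ j) / (1 - a * b) := by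
        rw [e]; field_simp
      simp only [hA]
      rw [qPoch_succ, qPoch_succ, e', Nat.choose_succ_succ' j 1, Nat.choose_one_right, pow_add,
        ← neg_mul, mul_pow, pow_succ (-a)]
      generalize hD : 1 - a * b * p ^ j = D at n2 ⊢
      field_simp
      rw [← hD]
      ring
    simp only [mul_assoc] at key
    have := hsplit
    simp only [hA] at this
    simp only [mul_assoc] at this ⊢
    rw [this]
    simp only [hA, mul_assoc] at hterm
    rw [Finset.sum_congr rfl hterm, ← Finset.mul_sum]
    rw [key, qPoch_succ', qPoch_succ' (a * b), mul_div_mul_comm]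
    congr 3
    ring

end Algebra

/-! ### The two identities in a field -/

section Identities

lemma choose_two_add (a b : ℕ) : (a + b).choose 2 = a.choose 2 + b.choose 2 + a * b := by
  induction b with
  | zero => simp
  | succ b ih =>
    rw [← add_assoc, Nat.choose_succ_succ' (a + b) 1, Nat.choose_succ_succ' b 1, ih]
    simp only [Nat.choose_one_right]
    ring

lemma sum_range_sub_add_choose_two {n j : ℕ} (hj : j ≤ n) :
    ∑ i ∈ Finset.range j, (n - i) + j.choose 2 = n * j := by
  induction j with
  | zero => simp
  | succ j ih =>
    have := ih (by omega)
    have h2 : (j + 1).choose 2 = j + j.choose 2 := by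
      rw [Nat.choose_succ_succ' j 1, Nat.choose_one_right]
    rw [Finset.sum_range_succ, h2, mul_add, ← this]
    omega

variable {K : Type*} [Field K] {q : K}

/-- Reading a shifted factorial from its last factor to its first. -/
lemma qPoch_reflect (hq : q ≠ 0) (c : K) (j : ℕ) :
    qPoch (c * q ^ (1 - j : ℤ)) q j = qPoch c q⁻¹ j := by
  unfold qPoch
  rw [← Finset.prod_range_reflect]
  refine Finset.prod_congr rfl fun i hi => ?_
  have hi' := Finset.mem_range.1 hi
  rw [mul_assoc, ← zpow_natCast, ← zpow_natCast, inv_zpow', ← zpow_add₀ hq]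
  congr 3
  omega

lemma hallTerm_eq (hq : Nontorsion q) (n m : ℕ) :
    hallTerm q n m = q ^ (m + 1).choose 2 * gauss q n m *
      (qPoch (-q ^ n) q⁻¹ m / qPoch (q ^ n * q ^ n) q⁻¹ m) := by
  have h0 := hq.ne_zero
  rw [hallTerm, ← qPoch_reflect h0 (-q ^ n) m, ← qPoch_reflect h0 (q ^ n * q ^ n) m]
  rw [← zpow_natCast q n, neg_mul, ← zpow_add₀ h0, ← zpow_add₀ h0, ← zpow_add₀ h0,
    show (n : ℤ) - m + 1 = n + (1 - m) by ring, show 2 * (n : ℤ) - m + 1 = n + n + (1 - m) by ring]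

/-- The recursion satisfied by the terms `hallTerm q n k`: the generating function of the lecture
hall partitions with `k` positive parts satisfies it because the parts `λ_i > n - i + 1` precede
the others. -/
lemma hallTerm_rec (hq : Nontorsion q) {n k : ℕ} (hk : k ≤ n) :
    hallTerm q n k = ∑ j ∈ Finset.range (k + 1), q ^ (∑ i ∈ Finset.range j, (n - i)) *
      (q ^ (k - j + 1).choose 2 * gauss q ((n - j : ℕ) : ℤ) (k - j)) * hallTerm q n j := by
  have h0 := hq.ne_zero
  -- `a = b = -q ^ n` makes `a b = q ^ (2 n)`, the parameter of the denominators
  have hcv := sum_gauss_chu_vandermonde hq.inv k (-q ^ n) (-q ^ n) (fun i hi => by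
    have : -q ^ n * -q ^ n * q⁻¹ ^ i = q ^ (2 * n - i : ℤ) := by
      rw [neg_mul_neg, ← zpow_natCast, ← zpow_natCast, inv_zpow', ← zpow_add₀ h0, ← zpow_add₀ h0]
      congr 1; ring
    rw [this]
    exact hq.zpow_ne_one (by omega))
  rw [hallTerm_eq hq]
  simp only [neg_mul_neg, neg_neg] at hcv
  rw [← hcv, Finset.mul_sum]
  refine Finset.sum_congr rfl fun j hj => ?_
  obtain ⟨r, rfl⟩ : ∃ r, k = j + r := ⟨k - j, by have := Finset.mem_range.1 hj; omega⟩
  have e1 := gauss_mul_gauss hq n j r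
  have e2 := gauss_inv hq ((j + r : ℕ) : ℤ) j
  have e3 : q ^ ((j : ℤ) * (((j + r : ℕ) : ℤ) - j)) = q ^ (j * r) := by
    rw [← zpow_natCast]; congr 1; push_cast; ring
  rw [e3] at e2
  have e4 : (q ^ (j + r + 1).choose 2 * (q ^ n) ^ j : K) =
      q ^ (∑ i ∈ Finset.range j, (n - i)) * q ^ (r + 1).choose 2 * q ^ (j + 1).choose 2 *
        q ^ (j * r) * q ^ j.choose 2 := by
    simp only [← pow_mul, ← pow_add]
    congr 1
    have a1 := sum_range_sub_add_choose_two (show j ≤ n by omega)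
    have a2 := choose_two_add j (r + 1)
    have a3 := choose_two_add j 1
    rw [add_assoc j r 1, a2, a3, ← a1]
    simp
    ring
  rw [hallTerm_eq hq, Nat.add_sub_cancel_left, Nat.cast_sub (show j ≤ n by omega)]
  have e5 : q⁻¹ ^ j.choose 2 * q ^ j.choose 2 = 1 := by
    rw [← mul_pow, inv_mul_cancel₀ h0, one_pow]
  set T := qPoch (-q ^ n) q⁻¹ j / qPoch (q ^ n * q ^ n) q⁻¹ j
  set g := gauss q⁻¹ ((j + r : ℕ) : ℤ) j
  set c := q ^ (∑ i ∈ Finset.range j, (n - i)) * q ^ (r + 1).choose 2 * q ^ (j + 1).choose 2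
  calc q ^ (j + r + 1).choose 2 * gauss q n (j + r) *
        (g * q⁻¹ ^ j.choose 2 * (q ^ n) ^ j * T)
      = (q ^ (j + r + 1).choose 2 * (q ^ n) ^ j) * gauss q n (j + r) * g *
          q⁻¹ ^ j.choose 2 * T := by ring
    _ = c * (gauss q n (j + r) * (q ^ (j * r) * g)) * T *
        (q⁻¹ ^ j.choose 2 * q ^ j.choose 2) := by rw [e4]; ring
    _ = _ := by rw [e5, ← e2, ← e1]; ring

/-- `q^{di} [m - 1 + i, i]_{q²}`, the generating function of the multisets of `i` elements of
`{d, d + 2, …, d + 2(m - 1)}`. -/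
noncomputable def progTerm (q : K) (d m i : ℕ) : K :=
  q ^ (d * i) * gauss (q ^ 2) ((m : ℤ) - 1 + i) i

@[simp]
lemma progTerm_zero_right (q : K) (d m : ℕ) : progTerm q d m 0 = 1 := by simp [progTerm]

lemma progTerm_zero_succ (hq : Nontorsion q) (d i : ℕ) : progTerm q d 0 (i + 1) = 0 := by
  have := gauss_neg_one_succ (hq.pow two_pos) i
  simp only [progTerm, Nat.cast_zero, zero_sub, this, mul_zero]

/-- Adjoining `d + 2m` at the top of the progression. -/
lemma progTerm_succ (hq : Nontorsion q) (d m i : ℕ) :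
    progTerm q d (m + 1) (i + 1) =
      progTerm q d m (i + 1) + q ^ (d + 2 * m) * progTerm q d (m + 1) i := by
  have h := gauss_pascal (hq.pow two_pos) ((m : ℤ) + i) i
  simp only [progTerm]
  have e1 : ((m + 1 : ℕ) : ℤ) - 1 + (i + 1 : ℕ) = m + i + 1 := by push_cast; ring
  have e2 : (m : ℤ) - 1 + (i + 1 : ℕ) = m + i := by push_cast; ring
  have e3 : ((m + 1 : ℕ) : ℤ) - 1 + i = m + i := by push_cast; ring
  rw [e1, e2, e3, h, add_sub_cancel_right, zpow_natCast]
  ring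

/-- Adjoining `d` at the bottom of the progression. -/
lemma progTerm_succ' (hq : Nontorsion q) (d m i : ℕ) :
    progTerm q d (m + 1) (i + 1) =
      progTerm q (d + 2) m (i + 1) + q ^ d * progTerm q d (m + 1) i := by
  have h := gauss_pascal' (hq.pow two_pos) ((m : ℤ) + i) i
  simp only [progTerm]
  have e1 : ((m + 1 : ℕ) : ℤ) - 1 + (i + 1 : ℕ) = m + i + 1 := by push_cast; ring
  have e2 : (m : ℤ) - 1 + (i + 1 : ℕ) = m + i := by push_cast; ring
  have e3 : ((m + 1 : ℕ) : ℤ) - 1 + i = m + i := by push_cast; ring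
  rw [e1, e2, e3, h]
  ring

/-- Summed form of `progTerm_succ`. -/
lemma sum_progTerm_top (hq : Nontorsion q) (d m f : ℕ) :
    ∑ i ∈ Finset.range (f + 1), progTerm q d m i =
      (1 - q ^ (d + 2 * m)) * ∑ i ∈ Finset.range f, progTerm q d (m + 1) i +
        progTerm q d (m + 1) f := by
  induction f with
  | zero => simp
  | succ f ih =>
    rw [Finset.sum_range_succ, ih, progTerm_succ hq, Finset.sum_range_succ _ f]
    ring

/-- Summed form of `progTerm_succ'`. -/
lemma sum_progTerm_bottom (hq : Nontorsion q) (d m f : ℕ) :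
    ∑ i ∈ Finset.range (f + 1), progTerm q (d + 2) m i =
      (1 - q ^ d) * ∑ i ∈ Finset.range (f + 1), progTerm q d (m + 1) i +
        q ^ d * progTerm q d (m + 1) f := by
  induction f with
  | zero => simp
  | succ f ih =>
    rw [Finset.sum_range_succ, ih, progTerm_succ' hq, Finset.sum_range_succ _ (f + 1),
      progTerm_succ' hq]
    ring

/-- `(q; q²)_c (q^{2n-1}; q⁻²)_f`, which is `∏ (1 - q^a)` over the odd numbers `a < 2n` that are
less than `2c` or greater than `2(n - f)`. -/
noncomputable def oddDenom (q : K) (n c f : ℕ) : K :=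
  qPoch q (q ^ 2) c * qPoch (q ^ (2 * (n : ℤ) - 1)) (q ^ (-2 : ℤ)) f

lemma oddDenom_succ_left (q : K) (n c f : ℕ) :
    oddDenom q n (c + 1) f = oddDenom q n c f * (1 - q ^ (2 * c + 1)) := by
  rw [oddDenom, qPoch_succ, oddDenom, ← pow_mul, pow_succ' q (2 * c)]
  ring

lemma oddDenom_succ_right (hq : q ≠ 0) {n f g : ℕ} (h : n = f + 1 + g) (c : ℕ) :
    oddDenom q n c (f + 1) = oddDenom q n c f * (1 - q ^ (2 * g + 1)) := by
  rw [oddDenom, qPoch_succ, oddDenom, ← zpow_natCast (q ^ (-2 : ℤ)), ← zpow_mul,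
    ← zpow_add₀ hq, ← zpow_natCast q (2 * g + 1), mul_assoc]
  congr 4
  push_cast [h]
  ring

lemma oddDenom_ne_zero (hq : Nontorsion q) {n c f : ℕ} (h : f ≤ n) : oddDenom q n c f ≠ 0 := by
  induction f with
  | zero =>
    induction c with
    | zero => simp [oddDenom]
    | succ c ih => rw [oddDenom_succ_left]; exact mul_ne_zero ih (hq.one_sub_pow_ne_zero _)
  | succ f ih =>
    rw [oddDenom_succ_right hq.ne_zero (show n = f + 1 + (n - (f + 1)) by omega)]
    exact mul_ne_zero (ih (by omega)) (hq.one_sub_pow_ne_zero _)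

lemma oddSum_eq {n k : ℕ} (hk : k ≤ n) :
    oddSum q n k = (∑ i ∈ Finset.range (k / 2 + 1),
      progTerm q (2 * ((k + 1) / 2) + 1) (n - k) i) / oddDenom q n ((k + 1) / 2) (k / 2) := by
  rw [oddSum, Finset.sum_div]
  refine Finset.sum_congr rfl fun i _ => ?_
  rw [progTerm, oddDenom, mul_comm i, Nat.cast_sub hk]

lemma oddTerm_eq {n k : ℕ} (hk : k ≤ n) :
    oddTerm q n k = q ^ ((k + 1) / 2 - k / 2) *
      progTerm q (2 * ((k + 1) / 2) + 1) (n - k + 1) (k / 2) /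
        oddDenom q n ((k + 1) / 2) (k / 2) := by
  rw [oddTerm, progTerm, oddDenom, ← mul_assoc, ← pow_add]
  have e1 : (n : ℤ) - ((k + 1) / 2 : ℕ) = ((n - k + 1 : ℕ) : ℤ) - 1 + (k / 2 : ℕ) := by omega
  have e2 : (k + 1).choose 2 = (k + 1) / 2 - k / 2 + (2 * ((k + 1) / 2) + 1) * (k / 2) := by
    rw [Nat.choose_two_right, Nat.add_sub_cancel]
    obtain ⟨f, rfl | rfl⟩ := k.even_or_odd'
    · have h1 : (2 * f + 1) / 2 = f := by omega
      have h2 : 2 * f / 2 = f := by omega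
      rw [h1, h2, show (2 * f + 1) * (2 * f) = (2 * f + 1) * f * 2 by ring,
        Nat.mul_div_cancel _ two_pos]
      omega
    · have h1 : (2 * f + 1 + 1) / 2 = f + 1 := by omega
      have h2 : (2 * f + 1) / 2 = f := by omega
      rw [h1, h2, show (2 * f + 1 + 1) * (2 * f + 1) = (f + 1) * (2 * f + 1) * 2 by ring,
        Nat.mul_div_cancel _ two_pos, Nat.add_sub_cancel_left]
      ring
  rw [e1, e2]

/-- For even `k` the letter `k + 1` leaves the bottom of the middle progression, for odd `k` the
letter `2n - k` leaves its top while the number of its elements that may be used rises by one. -/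
lemma oddSum_succ (hq : Nontorsion q) {n k : ℕ} (hk : k + 1 ≤ n) :
    oddSum q n (k + 1) = oddSum q n k + oddTerm q n (k + 1) := by
  rw [oddSum_eq hk, oddSum_eq (by omega), oddTerm_eq hk]
  obtain ⟨f, rfl | rfl⟩ := k.even_or_odd'
  · obtain ⟨m, rfl⟩ : ∃ m, n = 2 * f + 1 + m := ⟨n - (2 * f + 1), by omega⟩
    have h1 : (2 * f + 1 + 1) / 2 = f + 1 := by omega
    have h2 : (2 * f + 1) / 2 = f := by omega
    have h3 : 2 * f / 2 = f := by omega
    have h4 : 2 * f + 1 + m - (2 * f + 1) = m := by omega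
    have h5 : 2 * f + 1 + m - 2 * f = m + 1 := by omega
    rw [h1, h2, h3, h4, h5, show 2 * (f + 1) + 1 = 2 * f + 1 + 2 by ring,
      sum_progTerm_bottom hq, oddDenom_succ_left, Nat.add_sub_cancel_left]
    have n1 := oddDenom_ne_zero hq (c := f) (show f ≤ 2 * f + 1 + m by omega)
    have n2 := hq.one_sub_pow_ne_zero (2 * f)
    have e : q ^ (2 * f + 1) * progTerm q (2 * f + 1) (m + 1) f =
        q ^ 1 * progTerm q (2 * f + 1 + 2) (m + 1) f := by
      rw [progTerm, progTerm]; ring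
    rw [e]
    field_simp
  · obtain ⟨m, rfl⟩ : ∃ m, n = 2 * f + 2 + m := ⟨n - (2 * f + 2), by omega⟩
    have h1 : (2 * f + 1 + 1 + 1) / 2 = f + 1 := by omega
    have h2 : (2 * f + 1 + 1) / 2 = f + 1 := by omega
    have h3 : (2 * f + 1) / 2 = f := by omega
    have h4 : 2 * f + 2 + m - (2 * f + 1 + 1) = m := by omega
    have h5 : 2 * f + 2 + m - (2 * f + 1) = m + 1 := by omega
    have h6 : 2 * (f + 1) + 1 + 2 * m = 2 * (f + 1 + m) + 1 := by ring
    rw [h1, h2, h3, h4, h5, sum_progTerm_top hq, Nat.sub_self, pow_zero, one_mul, h6,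
      oddDenom_succ_right hq.ne_zero (show 2 * f + 2 + m = f + 1 + (f + 1 + m) by ring)]
    have n1 := oddDenom_ne_zero hq (c := f + 1) (show f ≤ 2 * f + 2 + m by omega)
    have n2 := hq.one_sub_pow_ne_zero (2 * (f + 1 + m))
    field_simp

lemma prod_range_even_odd {M : Type*} [CommMonoid M] (g : ℕ → M) (k : ℕ) :
    ∏ i ∈ Finset.range k, g i = (∏ i ∈ Finset.range ((k + 1) / 2), g (2 * i)) *
      ∏ i ∈ Finset.range (k / 2), g (2 * i + 1) := by
  induction k with
  | zero => simp
  | succ k ih =>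
    rw [Finset.prod_range_succ, ih]
    obtain ⟨f, rfl | rfl⟩ := k.even_or_odd'
    · have h1 : (2 * f + 1 + 1) / 2 = f + 1 := by omega
      have h2 : (2 * f + 1) / 2 = f := by omega
      have h3 : 2 * f / 2 = f := by omega
      rw [h1, h2, h3, Finset.prod_range_succ _ f, mul_right_comm]
    · have h1 : (2 * f + 1 + 1 + 1) / 2 = f + 1 := by omega
      have h2 : (2 * f + 1 + 1) / 2 = f + 1 := by omega
      have h3 : (2 * f + 1) / 2 = f := by omega
      rw [h1, h2, h3, Finset.prod_range_succ (fun i => g (2 * i + 1)) f, mul_assoc]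

lemma qPoch_even_odd (a p : K) (k : ℕ) :
    qPoch a p k = qPoch a (p ^ 2) ((k + 1) / 2) * qPoch (a * p) (p ^ 2) (k / 2) := by
  rw [qPoch, prod_range_even_odd]
  congr 1 <;> refine Finset.prod_congr rfl fun i _ => ?_ <;> ring

lemma qPoch_add (a p : K) (m n : ℕ) : qPoch a p (m + n) = qPoch a p m * qPoch (a * p ^ m) p n := by
  rw [qPoch, Finset.prod_range_add]
  congr 1
  refine Finset.prod_congr rfl fun i _ => ?_
  ring

lemma qPoch_neg_mul (a p : K) (k : ℕ) :
    qPoch a p k * qPoch (-a) p k = qPoch (a * a) (p ^ 2) k := by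
  rw [qPoch, qPoch, ← Finset.prod_mul_distrib]
  refine Finset.prod_congr rfl fun i _ => ?_
  ring

lemma gauss_eq (hq : q ≠ 0) (n : ℤ) (m : ℕ) :
    gauss q n m = qPoch (q ^ n) q⁻¹ m / qPoch q q m := by
  rw [gauss, ← qPoch_reflect hq, ← zpow_add₀ hq]
  congr 3
  ring

/-- Both sides split into even and odd exponents. -/
lemma hallTerm_eq_oddTerm (hq : Nontorsion q) {n k : ℕ} (hk : k ≤ n) :
    hallTerm q n k = oddTerm q n k := by
  have h0 := hq.ne_zero
  have hq2 := hq.pow two_pos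
  rw [hallTerm_eq hq, oddTerm, gauss_eq h0, gauss_eq hq2.ne_zero, qPoch_even_odd q q,
    qPoch_even_odd (q ^ n * q ^ n)]
  have hck : k = (k + 1) / 2 + k / 2 := by omega
  set c := (k + 1) / 2 with hc
  set f := k / 2 with hf
  have e1 := qPoch_neg_mul (q ^ n) q⁻¹ k
  rw [hck, qPoch_add _ (q⁻¹ ^ 2)] at e1
  rw [← hck] at e1
  have e2 : q ^ n * q ^ n * q⁻¹ = q ^ (2 * (n : ℤ) - 1) := by
    rw [← zpow_natCast, ← zpow_neg_one, ← zpow_add₀ h0, ← zpow_add₀ h0]; congr 1; ring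
  have e3 : (q ^ (-2 : ℤ) : K) = q⁻¹ ^ 2 := by rw [← zpow_natCast, inv_zpow']; rfl
  have e4 : q ^ n * q ^ n * (q⁻¹ ^ 2) ^ c = (q ^ 2) ^ ((n : ℤ) - c) := by
    rw [← pow_mul, ← zpow_natCast, ← zpow_natCast, ← zpow_natCast, inv_zpow', ← zpow_add₀ h0,
      ← zpow_add₀ h0, ← zpow_mul]
    congr 1; push_cast; ring
  have e5 : (q ^ 2)⁻¹ = q⁻¹ ^ 2 := by simp
  rw [e4] at e1
  rw [e2, e3, e5, zpow_natCast, ← pow_two q]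
  have n1 : qPoch (q ^ n * q ^ n) (q⁻¹ ^ 2) c ≠ 0 := qPoch_ne_zero fun i hi => by
    rw [← pow_mul, ← zpow_natCast, ← zpow_natCast, inv_zpow', ← zpow_add₀ h0, ← zpow_add₀ h0]
    exact hq.zpow_ne_one (by push_cast; omega)
  simp only [div_eq_mul_inv, mul_inv]
  set w := qPoch (q ^ n * q ^ n) (q⁻¹ ^ 2) c
  set u := (qPoch q (q ^ 2) c)⁻¹
  set v := (qPoch (q ^ 2) (q ^ 2) f)⁻¹
  set z := (qPoch (q ^ (2 * (n : ℤ) - 1)) (q⁻¹ ^ 2) f)⁻¹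
  set r := qPoch ((q ^ 2) ^ ((n : ℤ) - c)) (q⁻¹ ^ 2) f
  linear_combination (q ^ (k + 1).choose 2 * u * v * w⁻¹ * z) * e1 +
    (q ^ (k + 1).choose 2 * r * u * v * z) * mul_inv_cancel₀ n1

theorem sum_hallTerm_eq_oddSum (hq : Nontorsion q) {n k : ℕ} (hk : k ≤ n) :
    ∑ m ∈ Finset.range (k + 1), hallTerm q n m = oddSum q n k := by
  induction k with
  | zero => simp [hallTerm, oddSum]
  | succ k ih =>
    rw [Finset.sum_range_succ, ih (by omega), oddSum_succ hq hk, hallTerm_eq_oddTerm hq hk]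

end Identities

/-! ### Generating functions of weighted sets -/

section GenFun

lemma nontorsion_qvar : Nontorsion qvar where
  ne_zero := HahnSeries.single_ne_zero one_ne_zero
  pow_ne_one n hn h := by
    have := congrArg (fun f => HahnSeries.coeff f 0) h
    have hn' : (0 : ℤ) ≠ n := by omega
    simp [qvar, HahnSeries.single_pow, HahnSeries.coeff_single_of_ne hn'] at this

lemma genFun_injective : Function.Injective genFun := fun c d h => by
  have := HahnSeries.ofPowerSeries_injective h
  funext N
  simpa using congrArg (PowerSeries.coeff N) this

lemma coeff_genFun (c : ℕ → ℕ) (N : ℕ) : (genFun c).coeff N = c N := by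
  simp [genFun, HahnSeries.ofPowerSeries_apply_coeff]

lemma genFun_add (c d : ℕ → ℕ) : genFun (fun N => c N + d N) = genFun c + genFun d := by
  rw [genFun, genFun, genFun, ← map_add]
  congr 1
  ext N
  simp

lemma qvar_pow_mul_genFun (a : ℕ) (c : ℕ → ℕ) :
    qvar ^ a * genFun c = genFun fun N => if a ≤ N then c (N - a) else 0 := by
  rw [qvar, ← HahnSeries.ofPowerSeries_X (Γ := ℤ) (R := ℚ), genFun, ← map_pow, ← map_mul, genFun]
  congr 1
  ext N
  simp [PowerSeries.coeff_X_pow_mul', apply_ite (Nat.cast (R := ℚ))]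

lemma genFun_mul (c d : ℕ → ℕ) :
    genFun c * genFun d =
      genFun fun N => ∑ p ∈ Finset.HasAntidiagonal.antidiagonal N, c p.1 * d p.2 := by
  rw [genFun, genFun, genFun, ← map_mul]
  congr 1
  ext N
  simp [PowerSeries.coeff_mul]

variable {α β : Type*}

/-- The generating function `∑_{x ∈ S} q^{w(x)}` of a set `S` with weight function `w`. -/
noncomputable def gf (S : Set α) (w : α → ℕ) : LaurentSeries ℚ :=
  genFun fun N => {x | x ∈ S ∧ w x = N}.ncard

/-- There are finitely many elements of each weight. -/
def FinFibers (S : Set α) (w : α → ℕ) : Prop := ∀ N, {x | x ∈ S ∧ w x = N}.Finite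

lemma FinFibers.mono {S T : Set α} {w : α → ℕ} (hT : FinFibers T w) (h : S ⊆ T) :
    FinFibers S w :=
  fun N => (hT N).subset fun _ hx => ⟨h hx.1, hx.2⟩

lemma gf_congr {S T : Set α} {w : α → ℕ} (h : ∀ x, x ∈ S ↔ x ∈ T) : gf S w = gf T w := by
  rw [Set.ext h]

@[simp]
lemma gf_empty (w : α → ℕ) : gf ∅ w = 0 := by
  have : PowerSeries.mk (fun _ : ℕ => (0 : ℚ)) = 0 := by ext; simp
  simp [gf, genFun, this]

lemma gf_eq_one {S : Set α} {w : α → ℕ} (a : α) (hS : ∀ x, x ∈ S ↔ x = a) (ha : w a = 0) :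
    gf S w = 1 := by
  rw [gf, genFun, ← map_one (HahnSeries.ofPowerSeries ℤ ℚ)]
  congr 1
  ext N
  rw [PowerSeries.coeff_mk, PowerSeries.coeff_one]
  rcases eq_or_ne N 0 with rfl | hN
  · have : {x | x ∈ S ∧ w x = 0} = {a} := by
      ext x
      simp only [hS, Set.mem_ofPred_eq, Set.mem_singleton_iff, and_iff_left_iff_imp]
      rintro rfl; exact ha
    simp [this]
  · have : {x | x ∈ S ∧ w x = N} = ∅ := by
      ext x
      simp only [hS, Set.mem_ofPred_eq, Set.mem_empty_iff_false, iff_false]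
      rintro ⟨rfl, h⟩; omega
    simp [this, hN]

lemma gf_add_of_disjoint {S T U : Set α} {w : α → ℕ} (hU : FinFibers U w)
    (h : ∀ x, x ∈ U ↔ x ∈ S ∨ x ∈ T) (hd : ∀ x ∈ S, x ∉ T) : gf U w = gf S w + gf T w := by
  rw [gf, gf, gf, ← genFun_add]
  congr 1
  funext N
  rw [← Set.ncard_union_eq (Set.disjoint_left.2 fun x hx hx' => hd x hx.1 hx'.1)
    ((hU N).subset fun x hx => ⟨(h x).2 (.inl hx.1), hx.2⟩)
    ((hU N).subset fun x hx => ⟨(h x).2 (.inr hx.1), hx.2⟩)]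
  congr 1
  ext x
  simp only [h, Set.mem_ofPred_eq, Set.mem_union]
  tauto

/-- Sorting by a statistic `v`. -/
lemma gf_eq_sum {S : Set α} {w : α → ℕ} (hS : FinFibers S w) (v : α → ℕ) (t : ℕ) :
    gf {x | x ∈ S ∧ v x < t} w = ∑ i ∈ Finset.range t, gf {x | x ∈ S ∧ v x = i} w := by
  induction t with
  | zero => simp
  | succ t ih =>
    rw [Finset.sum_range_succ, ← ih]
    refine gf_add_of_disjoint (hS.mono fun x hx => hx.1) (fun x => ?_) fun x hx hx' => ?_
    · simp only [Set.mem_ofPred_eq, ← and_or_left, ← Nat.lt_succ_iff_lt_or_eq]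
    · exact hx.2.ne hx'.2

/-- A bijection that raises all weights by `a` multiplies the generating function by `q ^ a`. -/
lemma gf_bijOn {S : Set α} {T : Set β} {w : α → ℕ} {w' : β → ℕ} (e : α → β) (a : ℕ)
    (he : Set.BijOn e S T) (hw : ∀ x ∈ S, w' (e x) = a + w x) :
    gf T w' = qvar ^ a * gf S w := by
  rw [gf, gf, qvar_pow_mul_genFun]
  congr 1
  funext N
  split_ifs with h
  · have : {y | y ∈ T ∧ w' y = N} = e '' {x | x ∈ S ∧ w x = N - a} := by
      ext y
      constructor
      · rintro ⟨hy, hN⟩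
        obtain ⟨x, hx, rfl⟩ := he.surjOn hy
        exact ⟨x, ⟨hx, by have := hw x hx; omega⟩, rfl⟩
      · rintro ⟨x, ⟨hx, hN⟩, rfl⟩
        exact ⟨he.mapsTo hx, by have := hw x hx; omega⟩
    rw [this, (he.injOn.mono fun x hx => hx.1).ncard_image]
  · have : {y | y ∈ T ∧ w' y = N} = ∅ := by
      ext y
      simp only [Set.mem_ofPred_eq, Set.mem_empty_iff_false, iff_false]
      rintro ⟨hy, hN⟩
      obtain ⟨x, hx, rfl⟩ := he.surjOn hy
      have := hw x hx
      omega
    simp [this]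

lemma gf_prod {S : Set α} {T : Set β} {w : α → ℕ} {w' : β → ℕ} (hS : FinFibers S w)
    (hT : FinFibers T w') : gf (S ×ˢ T) (fun x => w x.1 + w' x.2) = gf S w * gf T w' := by
  classical
  rw [gf, gf, gf, genFun_mul]
  congr 1
  funext N
  have : {x : α × β | x ∈ S ×ˢ T ∧ w x.1 + w' x.2 = N} =
      ((Finset.HasAntidiagonal.antidiagonal N).biUnion fun p =>
        (hS p.1).toFinset ×ˢ (hT p.2).toFinset : Finset (α × β)) := by
    ext ⟨x, y⟩
    simp
    tauto
  rw [this, Set.ncard_coe_finset, Finset.card_biUnion]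
  · refine Finset.sum_congr rfl fun p _ => ?_
    rw [Finset.card_product, Set.ncard_eq_toFinset_card _ (hS p.1),
      Set.ncard_eq_toFinset_card _ (hT p.2)]
  · rintro p - p' - hne
    refine Finset.disjoint_left.2 ?_
    rintro ⟨x, y⟩ h h'
    simp only [Finset.mem_product, Set.Finite.mem_toFinset, Set.mem_ofPred_eq] at h h'
    exact hne (Prod.ext (h.1.2.symm.trans h'.1.2) (h.2.2.symm.trans h'.2.2))

end GenFun

/-! ### Lecture hall partitions -/

section Hall

/-- The elements of `L_{n,k}` with `k` positive parts, as functions on `ℕ` that vanish from `k` on;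
the condition on the ratios is stated for consecutive parts. -/
def hallSet (n k : ℕ) : Set (ℕ → ℕ) :=
  {f | (∀ i, 0 < f i ↔ i < k) ∧ ∀ i, i + 1 < k → f (i + 1) * (n - i) ≤ f i * (n - (i + 1))}

/-- The strictly decreasing sequences of `r` elements of `{1, …, m}`, as functions on `ℕ` that
vanish from `r` on. -/
def strictSeq (m r : ℕ) : Set (ℕ → ℕ) :=
  {f | (∀ i, 0 < f i ↔ i < r) ∧ (∀ i, i + 1 < r → f (i + 1) < f i) ∧ ∀ i, i < r → f i + i ≤ m}

/-- The sum of the first `k` values. -/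
def weight (k : ℕ) (f : ℕ → ℕ) : ℕ := ∑ i ∈ Finset.range k, f i

lemma finFibers_weight (k : ℕ) {S : Set (ℕ → ℕ)} (hS : ∀ f ∈ S, ∀ i, 0 < f i → i < k) :
    FinFibers S (weight k) := fun N => by
  refine Set.Finite.of_finite_image (f := fun f (i : Fin k) => f i) ?_ ?_
  · refine (Set.Finite.pi' (ι := Fin k) (t := fun _ => Set.Iic N)
      fun _ => Set.finite_Iic N).subset ?_
    rintro _ ⟨f, ⟨-, hN⟩, rfl⟩ i
    rw [Set.mem_Iic, ← hN]
    exact Finset.single_le_sum (f := f) (fun _ _ => Nat.zero_le _) (Finset.mem_range.2 i.2)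
  · intro f hf g hg h
    funext i
    by_cases hi : i < k
    · exact congrFun h ⟨i, hi⟩
    · rw [Nat.eq_zero_of_not_pos fun h' => hi (hS f hf.1 i h'),
        Nat.eq_zero_of_not_pos fun h' => hi (hS g hg.1 i h')]

lemma finFibers_hallSet (n k : ℕ) : FinFibers (hallSet n k) (weight k) :=
  finFibers_weight k fun _ hf i hi => (hf.1 i).1 hi

lemma finFibers_strictSeq (m r : ℕ) : FinFibers (strictSeq m r) (weight r) :=
  finFibers_weight r fun _ hf i hi => (hf.1 i).1 hi

/-- Either the largest element is `m + 1`, or all elements are at most `m`. -/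
lemma gf_strictSeq_succ (m r : ℕ) :
    gf (strictSeq (m + 1) (r + 1)) (weight (r + 1)) =
      gf (strictSeq m (r + 1)) (weight (r + 1)) +
        qvar ^ (m + 1) * gf (strictSeq m r) (weight r) := by
  have hb : Set.BijOn (fun f i => Nat.casesOn (motive := fun _ => ℕ) i (m + 1) f)
      (strictSeq m r) {f | f ∈ strictSeq (m + 1) (r + 1) ∧ f 0 = m + 1} := by
    refine ⟨?_, ?_, ?_⟩
    · rintro f ⟨h1, h2, h3⟩
      refine ⟨⟨?_, ?_, ?_⟩, rfl⟩
      · rintro (_ | i)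
        · simp
        · simp [h1]
      · rintro (_ | i) hi
        · have := h3 0 (by omega)
          change f 0 < m + 1
          omega
        · exact h2 i (by omega)
      · rintro (_ | i) hi
        · simp
        · have := h3 i (by omega)
          change f i + (i + 1) ≤ m + 1
          omega
    · intro f _ g _ h
      funext i
      exact congrFun h (i + 1)
    · rintro f ⟨⟨h1, h2, h3⟩, h0⟩
      refine ⟨fun i => f (i + 1), ⟨fun i => by simp [h1], fun i hi => h2 _ (by omega),
        fun i hi => ?_⟩, ?_⟩
      · have := h3 (i + 1) (by omega)
        dsimp only
        omega
      · funext i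
        cases i <;> simp [h0]
  rw [← gf_bijOn _ (m + 1) hb (w' := weight (r + 1)) fun f _ => by
    rw [weight, Finset.sum_range_succ']; exact add_comm _ _]
  refine gf_add_of_disjoint (finFibers_strictSeq _ _) (fun f => ?_) ?_
  · constructor
    · rintro ⟨h1, h2, h3⟩
      by_cases h0 : f 0 = m + 1
      · exact .inr ⟨⟨h1, h2, h3⟩, h0⟩
      · refine .inl ⟨h1, h2, fun i => ?_⟩
        induction i with
        | zero => intro hi; have := h3 0 hi; omega
        | succ i ih => intro hi; have := h2 i hi; have := ih (by omega); omega
    · rintro (⟨h1, h2, h3⟩ | h)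
      · exact ⟨h1, h2, fun i hi => (h3 i hi).trans (by omega)⟩
      · exact h.1
  · rintro f ⟨-, -, h⟩ ⟨-, h'⟩
    have := h 0 (by omega)
    omega

lemma gf_strictSeq (m r : ℕ) :
    gf (strictSeq m r) (weight r) = qvar ^ (r + 1).choose 2 * gauss qvar m r := by
  have hq := nontorsion_qvar
  induction m generalizing r with
  | zero =>
    cases r with
    | zero =>
      rw [gf_eq_one 0 (fun f => ?_) rfl]
      · simp
      · constructor
        · intro h
          funext i
          have := (h.1 i).not
          simpa using this
        · rintro rfl; simp [strictSeq]
    | succ r =>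
      have : strictSeq 0 (r + 1) = ∅ := by
        ext f
        simp only [Set.mem_empty_iff_false, iff_false]
        rintro ⟨h1, -, h3⟩
        have := h3 0 (by omega)
        have := (h1 0).2 (by omega)
        omega
      have e : gauss qvar ((0 : ℕ) : ℤ) (r + 1) = 0 := by
        have h0 : qPoch (qvar ^ (((0 : ℕ) : ℤ) - (r + 1 : ℕ) + 1)) qvar (r + 1) = 0 := by
          refine Finset.prod_eq_zero (Finset.mem_range.2 (Nat.lt_succ_self r)) ?_
          rw [← zpow_natCast, ← zpow_add₀ hq.ne_zero]
          simp
        rw [gauss, h0, zero_div]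
      rw [this, gf_empty, e, mul_zero]
  | succ m ih =>
    cases r with
    | zero =>
      rw [gf_eq_one 0 (fun f => ?_) rfl]
      · simp
      · constructor
        · intro h
          funext i
          have := (h.1 i).not
          simpa using this
        · rintro rfl; simp [strictSeq]
    | succ r =>
      rw [gf_strictSeq_succ, ih, ih, Nat.cast_succ, gauss_pascal hq, mul_add, ← mul_assoc,
        ← mul_assoc]
      congr 2
      rw [← zpow_natCast, ← zpow_natCast, ← zpow_natCast, ← zpow_add₀ hq.ne_zero,
        ← zpow_add₀ hq.ne_zero, Nat.choose_succ_succ' (r + 1) 1, Nat.choose_one_right]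
      congr 1
      push_cast
      ring

/-- If `P` holds on an initial segment of `{0, …, k - 1}`, counting locates its end. -/
lemma card_filter_range_eq_iff {P : ℕ → Prop} [DecidablePred P] {k j : ℕ}
    (hP : ∀ i i', i ≤ i' → i' < k → P i' → P i) (hj : j ≤ k) :
    ((Finset.range k).filter P).card = j ↔ ∀ i < k, (P i ↔ i < j) := by
  have key : ∀ j ≤ k, (∀ i < k, (P i ↔ i < j)) → ((Finset.range k).filter P).card = j := by
    intro j hj h
    have : (Finset.range k).filter P = Finset.range j := by
      ext i
      simp only [Finset.mem_filter, Finset.mem_range]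
      constructor
      · rintro ⟨h1, h2⟩; exact (h i h1).1 h2
      · intro h1; exact ⟨by omega, (h i (by omega)).2 h1⟩
    rw [this, Finset.card_range]
  refine ⟨fun h => ?_, key j hj⟩
  obtain ⟨j', hj', h'⟩ : ∃ j' ≤ k, ∀ i < k, (P i ↔ i < j') := by
    have hex : ∃ j', k ≤ j' ∨ ¬ P j' := ⟨k, .inl le_rfl⟩
    refine ⟨Nat.find hex, Nat.find_min' hex (.inl le_rfl), fun i hi => ?_⟩
    constructor
    · intro hlt
      by_contra hc
      rcases Nat.find_spec hex with h1 | h1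
      · omega
      · exact h1 (hP _ i (by omega) hi hlt)
    · intro hlt
      have := Nat.find_min hex hlt
      push Not at this
      exact this.2
  rw [← h, key j' hj' h']
  exact h'

/-- The parts larger than `n - i` (for the index `i`, counted from `0`) are an initial segment. -/
lemma hallSet_lt_of_lt {n k : ℕ} (hk : k ≤ n) {f : ℕ → ℕ} (hf : f ∈ hallSet n k) {i i' : ℕ}
    (h : i ≤ i') (hi' : i' < k) (hlt : n - i' < f i') : n - i < f i := by
  induction i', h using Nat.le_induction with
  | base => exact hlt
  | succ i' h ih =>
    refine ih (by omega) ?_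
    have h1 := hf.2 i' hi'
    obtain ⟨a, ha⟩ : ∃ a, n - (i' + 1) = a + 1 := ⟨n - (i' + 1) - 1, by omega⟩
    have hb : n - i' = a + 2 := by omega
    rw [ha, hb] at h1
    rw [ha] at hlt
    rw [hb]
    by_contra hc
    nlinarith

/-- The number of parts larger than `n - i`, where `i` is the index counted from `0`. -/
def numLarge (n k : ℕ) (f : ℕ → ℕ) : ℕ := ((Finset.range k).filter fun i => n - i < f i).card

lemma numLarge_eq_iff {n k : ℕ} (hk : k ≤ n) {f : ℕ → ℕ} (hf : f ∈ hallSet n k) {j : ℕ}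
    (hj : j ≤ k) : numLarge n k f = j ↔ ∀ i < k, (n - i < f i ↔ i < j) :=
  card_filter_range_eq_iff (fun _ _ h hi => hallSet_lt_of_lt hk hf h hi) hj

/-- A lecture hall partition in which exactly `j` parts are larger than `n - i` is determined by
these parts, which, diminished by `n - i`, form a lecture hall partition, and by the remaining
ones, which form a strictly decreasing sequence in `{1, …, n - j}`. -/
lemma bijOn_hallSet {n k j : ℕ} (hk : k ≤ n) (hj : j ≤ k) :
    Set.BijOn (fun (p : (ℕ → ℕ) × (ℕ → ℕ)) i => if i < j then n - i + p.1 i else p.2 (i - j))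
      (hallSet n j ×ˢ strictSeq (n - j) (k - j)) {f | f ∈ hallSet n k ∧ numLarge n k f = j} := by
  refine ⟨?_, ?_, ?_⟩
  · rintro ⟨g, h⟩ ⟨⟨hg1, hg2⟩, hh1, hh2, hh3⟩
    dsimp only at hg1 hg2 hh1 hh2 hh3
    have hmem : (fun i => if i < j then n - i + g i else h (i - j)) ∈ hallSet n k := by
      refine ⟨fun i => ?_, fun i hi => ?_⟩
      · by_cases hij : i < j
        · simp only [hij, if_true]; omega
        · simp only [hij, if_false, hh1]; omega
      · rcases lt_trichotomy (i + 1) j with hij | hij | hij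
        · have := hg2 i hij
          simp only [hij, show i < j by omega, if_true, add_mul]
          rw [mul_comm (n - i) (n - (i + 1))]
          omega
        · have h0 := hh3 0 (by omega)
          have hij' : i < j := by omega
          simp only [lt_irrefl, if_true, if_false, hij, hij', Nat.sub_self]
          rw [mul_comm]
          exact Nat.mul_le_mul (by omega) (by omega)
        · have h1 := hh2 (i - j) (by omega)
          have h2 := hh3 (i - j) (by omega)
          simp only [show ¬ i + 1 < j by omega, show ¬ i < j by omega, if_false]
          rw [show i + 1 - j = i - j + 1 by omega]
          obtain ⟨a, ha⟩ : ∃ a, n - i = a + 1 := ⟨n - i - 1, by omega⟩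
          rw [show n - (i + 1) = a by omega, ha]
          have h3 : h (i - j) ≤ a + 1 := by omega
          nlinarith
    refine ⟨hmem, (numLarge_eq_iff hk hmem hj).2 fun i hi => ?_⟩
    by_cases hij : i < j
    · have := (hg1 i).2 hij
      simp only [hij, if_true, iff_true]; omega
    · have := hh3 (i - j) (by omega)
      simp only [hij, if_false, iff_false]; omega
  · rintro ⟨g, h⟩ ⟨⟨hg1, -⟩, hh1, -⟩ ⟨g', h'⟩ ⟨⟨hg1', -⟩, hh1', -⟩ heq
    simp only [Prod.mk.injEq] at *
    constructor <;> funext i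
    · by_cases hij : i < j
      · have := congrFun heq i
        simp only [hij, if_true] at this
        omega
      · have := hg1 i; have := hg1' i; omega
    · have := congrFun heq (i + j)
      simpa using this
  · rintro f ⟨hf, hj'⟩
    rw [numLarge_eq_iff hk hf hj] at hj'
    obtain ⟨hf1, hf2⟩ := hf
    refine ⟨(fun i => if i < j then f i - (n - i) else 0, fun i => f (i + j)),
      ⟨⟨fun i => ?_, fun i hi => ?_⟩, fun i => ?_, fun i hi => ?_, fun i hi => ?_⟩, ?_⟩
    · by_cases hij : i < j
      · have := (hj' i (by omega)).2 hij
        simp only [hij, if_true, iff_true]; omega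
      · simp [hij]
    · have h1 := (hj' i (by omega)).2 (by omega)
      have h2 := (hj' (i + 1) (by omega)).2 hi
      have h3 := hf2 i (by omega)
      simp only [show i < j by omega, hi, if_true]
      rw [Nat.sub_mul (f (i + 1)), Nat.sub_mul (f i), mul_comm (n - (i + 1)) (n - i)]
      omega
    · simp only [hf1]; omega
    · have h1 := (hj' (i + j) (by omega)).not.2 (by omega)
      have h2 := hf2 (i + j) (by omega)
      have h3 := (hf1 (i + j)).2 (by omega)
      simp only [show i + 1 + j = i + j + 1 by omega]
      obtain ⟨a, ha⟩ : ∃ a, n - (i + j) = a + 1 := ⟨n - (i + j) - 1, by omega⟩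
      rw [ha, show n - (i + j + 1) = a by omega] at h2
      by_contra hc
      nlinarith
    · have h1 := (hj' (i + j) (by omega)).not.2 (by omega)
      simp only; omega
    · funext i
      by_cases hij : i < j
      · have h1 := (hj' i (by omega)).2 hij
        simp only [hij, if_true]; omega
      · simp only [hij, if_false]
        congr 1; omega

lemma gf_hallSet_rec {n k : ℕ} (hk : k ≤ n) :
    gf (hallSet n k) (weight k) = ∑ j ∈ Finset.range (k + 1),
      qvar ^ (∑ i ∈ Finset.range j, (n - i)) *
        (qvar ^ (k - j + 1).choose 2 * gauss qvar ((n - j : ℕ) : ℤ) (k - j)) *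
          gf (hallSet n j) (weight j) := by
  have hlt : ∀ f, f ∈ hallSet n k ↔ f ∈ {f | f ∈ hallSet n k ∧ numLarge n k f < k + 1} :=
    fun f => ⟨fun h => ⟨h, Nat.lt_succ_of_le
      ((Finset.card_filter_le _ _).trans (Finset.card_range k).le)⟩, fun h => h.1⟩
  rw [gf_congr hlt, gf_eq_sum (finFibers_hallSet n k)]
  refine Finset.sum_congr rfl fun j hj => ?_
  have hj' : j ≤ k := by have := Finset.mem_range.1 hj; omega
  rw [gf_bijOn _ (∑ i ∈ Finset.range j, (n - i)) (bijOn_hallSet hk hj')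
    (w := fun p => weight j p.1 + weight (k - j) p.2),
    gf_prod (finFibers_hallSet _ _) (finFibers_strictSeq _ _), gf_strictSeq]
  · ring
  · rintro ⟨g, h⟩ -
    rw [weight, ← Nat.add_sub_cancel' hj', Finset.sum_range_add, weight, weight, ← add_assoc,
      ← Finset.sum_add_distrib, Nat.add_sub_cancel_left]
    congr 1
    · exact Finset.sum_congr rfl fun i hi => by simp [Finset.mem_range.1 hi]
    · exact Finset.sum_congr rfl fun i _ => by simp

theorem gf_hallSet {n k : ℕ} (hk : k ≤ n) : gf (hallSet n k) (weight k) = hallTerm qvar n k := by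
  have hq := nontorsion_qvar
  induction k using Nat.strong_induction_on with
  | _ k ih =>
    rcases Nat.eq_zero_or_pos k with rfl | hpos
    · rw [gf_eq_one 0 (fun f => ?_) rfl]
      · simp [hallTerm]
      · constructor
        · intro h
          funext i
          have := (h.1 i).not
          simpa using this
        · rintro rfl; simp [hallSet]
    · have h1 := gf_hallSet_rec hk
      have h2 := hallTerm_rec hq hk
      rw [Finset.sum_range_succ] at h1 h2
      rw [Finset.sum_congr rfl fun j hj => by
        rw [ih j (Finset.mem_range.1 hj) (by have := Finset.mem_range.1 hj; omega)]] at h1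
      have hne : qvar ^ (∑ i ∈ Finset.range k, (n - i)) ≠ 1 := by
        refine hq.pow_ne_one _ ?_
        exact Finset.sum_pos' (fun _ _ => Nat.zero_le _)
          ⟨0, Finset.mem_range.2 hpos, by omega⟩
      simp only [Nat.sub_self, zero_add, gauss_zero_right, mul_one,
        show (1 : ℕ).choose 2 = 0 from rfl, pow_zero] at h1 h2
      -- the term `j = k` of the recursion is the generating function itself times `q ^ e`, `e > 0`
      refine mul_left_cancel₀ (sub_ne_zero.2 hne.symm) ?_
      linear_combination h1 - h2

lemma mem_truncatedHall_iff {n k : ℕ} (hk : k ≤ n) (f : ℕ → ℕ) :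
    (fun i : Fin k => f i) ∈ truncatedHall n k ↔
      ∀ i, i + 1 < k → f (i + 1) * (n - i) ≤ f i * (n - (i + 1)) := by
  have hpos : ∀ i, i < k → (0 : ℚ) < (n : ℚ) - i := fun i hi =>
    sub_pos.2 (Nat.cast_lt.2 (by omega))
  have hstep : ∀ i, i + 1 < k → (f (i + 1) * (n - i) ≤ f i * (n - (i + 1)) ↔
      (f (i + 1) : ℚ) / ((n : ℚ) - (i + 1 : ℕ)) ≤ f i / ((n : ℚ) - i)) := fun i hi => by
    rw [div_le_div_iff₀ (hpos _ hi) (hpos i (by omega)), ← Nat.cast_sub (by omega),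
      ← Nat.cast_sub (by omega)]
    exact_mod_cast Iff.rfl
  constructor
  · rintro ⟨-, h⟩ i hi
    rw [hstep i hi]
    exact h (a := ⟨i, by omega⟩) (b := ⟨i + 1, hi⟩) (by simp)
  · intro h
    constructor
    · rintro ⟨i, hi⟩ ⟨j, hj⟩ hij
      have hij' : i ≤ j := hij
      clear hij
      change f j ≤ f i
      induction j, hij' using Nat.le_induction with
      | base => exact le_rfl
      | succ j hij ih =>
        refine le_trans ?_ (ih (by omega))
        have h1 := h j hj
        by_contra hc
        obtain ⟨a, ha⟩ : ∃ a, n - j = a + 1 := ⟨n - j - 1, by omega⟩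
        rw [ha, show n - (j + 1) = a by omega] at h1
        nlinarith
    · rintro ⟨i, hi⟩ ⟨j, hj⟩ hij
      have hij' : i ≤ j := hij
      clear hij
      change (f j : ℚ) / ((n : ℚ) - j) ≤ f i / ((n : ℚ) - i)
      induction j, hij' using Nat.le_induction with
      | base => exact le_rfl
      | succ j hij ih => exact ((hstep j hj).1 (h j hj)).trans (ih (by omega))

/-- The number of positive entries. -/
def numPos {k : ℕ} (l : Fin k → ℕ) : ℕ :=
  ((Finset.range k).filter fun i => ∃ h : i < k, 0 < l ⟨i, h⟩).card

lemma numPos_eq_iff {n k m : ℕ} (hm : m ≤ k) {l : Fin k → ℕ} (hl : l ∈ truncatedHall n k) :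
    numPos l = m ↔ ∀ i, (∃ h : i < k, 0 < l ⟨i, h⟩) ↔ i < m := by
  rw [numPos, card_filter_range_eq_iff ?_ hm]
  · constructor
    · intro h i
      by_cases hi : i < k
      · exact h i hi
      · simp only [hi, IsEmpty.exists_iff, false_iff]; omega
    · exact fun h i _ => h i
  · rintro i i' hii hi' ⟨_, h⟩
    have hi : i < k := by omega
    exact ⟨hi, h.trans_le (hl.1 (show (⟨i, hi⟩ : Fin k) ≤ ⟨i', hi'⟩ from hii))⟩

lemma bijOn_truncatedHall {n k m : ℕ} (hk : k ≤ n) (hm : m ≤ k) :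
    Set.BijOn (fun f (i : Fin k) => f i) (hallSet n m)
      {l | l ∈ truncatedHall n k ∧ numPos l = m} := by
  refine ⟨?_, ?_, ?_⟩
  · rintro f ⟨h1, h2⟩
    have hf : (fun i : Fin k => f i) ∈ truncatedHall n k := by
      rw [mem_truncatedHall_iff hk]
      intro i hi
      by_cases him : i + 1 < m
      · exact h2 i him
      · have : f (i + 1) = 0 := by have := (h1 (i + 1)).not; omega
        simp [this]
    refine ⟨hf, (numPos_eq_iff hm hf).2 fun i => ?_⟩
    simp only [h1, exists_prop, and_iff_right_iff_imp]
    omega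
  · intro f hf g hg h
    funext i
    by_cases hi : i < k
    · exact congrFun h ⟨i, hi⟩
    · have := (hf.1 i).not; have := (hg.1 i).not; omega
  · rintro l ⟨hl, hlm⟩
    rw [numPos_eq_iff hm hl] at hlm
    have hr : (fun i : Fin k => if h : (i : ℕ) < k then l ⟨i, h⟩ else 0) = l := by
      funext i; simp
    refine ⟨fun i => if h : i < k then l ⟨i, h⟩ else 0, ⟨fun i => ?_, fun i hi => ?_⟩, hr⟩
    · rw [← hlm]
      by_cases hi : i < k <;> simp [hi]
    · rw [← hr, mem_truncatedHall_iff hk fun i => if h : i < k then l ⟨i, h⟩ else 0] at hl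
      exact hl i (by omega)

lemma gf_truncatedHall_numPos {n k m : ℕ} (hk : k ≤ n) (hm : m ≤ k) :
    gf {l | l ∈ truncatedHall n k ∧ numPos l = m} (fun l => ∑ i, l i) = hallTerm qvar n m := by
  rw [gf_bijOn _ 0 (bijOn_truncatedHall hk hm) (w := weight m), pow_zero, one_mul,
    gf_hallSet (hm.trans hk)]
  intro f hf
  rw [zero_add, weight, Fin.sum_univ_eq_sum_range]
  refine (Finset.sum_subset (Finset.range_mono hm) fun i _ hi => ?_).symm
  have := (hf.1 i).not
  simp only [Finset.mem_range] at hi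
  omega

lemma numPos_le {k : ℕ} (l : Fin k → ℕ) : numPos l ≤ k :=
  (Finset.card_filter_le _ _).trans (Finset.card_range k).le

theorem genFun_truncatedHall {n k : ℕ} (hk : k ≤ n) :
    genFun (numOfWeight (truncatedHall n k)) = ∑ m ∈ Finset.range (k + 1), hallTerm qvar n m := by
  have hfin : FinFibers (truncatedHall n k) (fun l => ∑ i, l i) := fun N => by
    refine (Set.Finite.pi' (ι := Fin k) (t := fun _ => Set.Iic N)
      fun _ => Set.finite_Iic N).subset ?_
    rintro l ⟨-, hN⟩ i
    rw [Set.mem_Iic, ← hN]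
    exact Finset.single_le_sum (f := l) (fun _ _ => Nat.zero_le _) (Finset.mem_univ i)
  change gf (truncatedHall n k) (fun l => ∑ i, l i) = _
  rw [gf_congr (T := {l | l ∈ truncatedHall n k ∧ numPos l < k + 1}) fun l =>
    ⟨fun h => ⟨h, Nat.lt_succ_of_le (numPos_le l)⟩, fun h => h.1⟩, gf_eq_sum hfin]
  exact Finset.sum_congr rfl fun m hm =>
    gf_truncatedHall_numPos hk (Nat.le_of_lt_succ (Finset.mem_range.1 hm))

theorem genFun_positiveHall {n k : ℕ} (hk : k ≤ n) :
    genFun (numOfWeight (positiveHall n k)) = hallTerm qvar n k := by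
  rw [← gf_truncatedHall_numPos hk le_rfl]
  refine gf_congr fun l => and_congr_right fun hl => ?_
  rw [numPos_eq_iff le_rfl hl]
  constructor
  · exact fun h i => ⟨fun h' => h'.1, fun h' => ⟨h', h _⟩⟩
  · exact fun h i => ((h i).2 i.2).2

end Hall

/-! ### Partitions into odd parts -/

section Partitions

lemma numPartitions_eq (P : Multiset ℕ → Prop) (N : ℤ) : numPartitions P N =
    if 0 ≤ N then {s : Multiset ℕ | s ∈ {s | (∀ x ∈ s, 0 < x) ∧ P s} ∧ s.sum = N.toNat}.ncard
    else 0 := by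
  classical
  rw [numPartitions]
  congr 1
  rw [← Finset.card_image_of_injective _ (f := Nat.Partition.parts) fun p p' => Nat.Partition.ext,
    ← Set.ncard_coe_finset]
  congr 1
  ext s
  simp only [Finset.coe_image, Finset.coe_filter, Finset.mem_univ, true_and, Set.mem_image,
    Set.mem_ofPred_eq]
  constructor
  · rintro ⟨p, hp, rfl⟩
    exact ⟨⟨fun x hx => p.parts_pos hx, hp⟩, p.parts_sum⟩
  · rintro ⟨⟨h1, h2⟩, h3⟩
    exact ⟨⟨s, fun hx => h1 _ hx, h3⟩, h2, rfl⟩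

lemma genFun_numPartitions (P : Multiset ℕ → Prop) :
    genFun (fun N => numPartitions P N) = gf {s | (∀ x ∈ s, 0 < x) ∧ P s} Multiset.sum := by
  rw [gf]
  congr 1
  funext N
  rw [numPartitions_eq, if_pos (Int.natCast_nonneg N), Int.toNat_natCast]

lemma finFibers_multiset {S : Set (Multiset ℕ)} (hS : ∀ s ∈ S, ∀ x ∈ s, 0 < x) :
    FinFibers S Multiset.sum := fun N => by
  refine (Set.finite_range (Nat.Partition.parts (n := N))).subset ?_
  rintro s ⟨h1, h2⟩
  exact ⟨⟨s, fun hx => hS s h1 _ hx, h2⟩, rfl⟩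

lemma numPartitions_congr {P Q : Multiset ℕ → Prop} {N : ℤ}
    (h : ∀ s : Multiset ℕ, (∀ x ∈ s, 0 < x ∧ (x : ℤ) ≤ N) → (P s ↔ Q s)) :
    numPartitions P N = numPartitions Q N := by
  rw [numPartitions_eq, numPartitions_eq]
  split_ifs with hN
  · congr 1
    ext s
    simp only [Set.mem_ofPred_eq, and_assoc]
    refine and_congr_right fun h1 => and_congr_left fun h2 => h s fun x hx => ⟨h1 x hx, ?_⟩
    have := Multiset.single_le_sum (fun _ _ => Nat.zero_le _) x hx
    omega
  · rfl

/-- The multisets with elements in `A ∪ B`, exactly `i` of which are in `B`. -/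
def letterSet (A B : Finset ℕ) (i : ℕ) : Set (Multiset ℕ) :=
  {s | s ∈ {s : Multiset ℕ | ∀ x ∈ s, x ∈ A ∨ x ∈ B} ∧ s.countP (· ∈ B) = i}

lemma finFibers_letters {A B : Finset ℕ} (hA : ∀ x ∈ A, 0 < x) (hB : ∀ x ∈ B, 0 < x) :
    FinFibers {s : Multiset ℕ | ∀ x ∈ s, x ∈ A ∨ x ∈ B} Multiset.sum :=
  finFibers_multiset fun _ hs x hx => (hs x hx).elim (hA x) (hB x)

/-- Adjoining a free letter `a`: a multiset either avoids `a` or arises by adding one `a`. -/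
lemma gf_letterSet_insert_left {A B : Finset ℕ} (hA : ∀ x ∈ A, 0 < x) (hB : ∀ x ∈ B, 0 < x)
    {a : ℕ} (ha : 0 < a) (haA : a ∉ A) (haB : a ∉ B) (i : ℕ) :
    gf (letterSet (insert a A) B i) Multiset.sum =
      gf (letterSet A B i) Multiset.sum +
        qvar ^ a * gf (letterSet (insert a A) B i) Multiset.sum := by
  have hb : Set.BijOn (fun s => a ::ₘ s) (letterSet (insert a A) B i)
      {s | s ∈ letterSet (insert a A) B i ∧ a ∈ s} := by
    refine ⟨?_, fun s _ t _ h => (Multiset.cons_inj_right a).1 h, ?_⟩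
    · rintro s ⟨h1, h2⟩
      refine ⟨⟨fun x hx => ?_, ?_⟩, Multiset.mem_cons_self a s⟩
      · rcases Multiset.mem_cons.1 hx with rfl | hx
        · simp
        · exact h1 x hx
      · rw [Multiset.countP_cons_of_neg _ haB, h2]
    · rintro s ⟨⟨h1, h2⟩, h3⟩
      obtain ⟨t, rfl⟩ := Multiset.exists_cons_of_mem h3
      rw [Multiset.countP_cons_of_neg _ haB] at h2
      exact ⟨t, ⟨fun x hx => h1 x (Multiset.mem_cons_of_mem hx), h2⟩, rfl⟩
  rw [← gf_bijOn _ a hb (w' := Multiset.sum) fun s _ => Multiset.sum_cons a s]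
  have hA' : ∀ x ∈ insert a A, 0 < x := by simpa [ha] using hA
  refine gf_add_of_disjoint ((finFibers_letters hA' hB).mono fun s hs => hs.1) (fun s => ?_) ?_
  · constructor
    · rintro ⟨h1, h2⟩
      by_cases has : a ∈ s
      · exact .inr ⟨⟨h1, h2⟩, has⟩
      · refine .inl ⟨fun x hx => ?_, h2⟩
        rcases h1 x hx with h | h
        · rcases Finset.mem_insert.1 h with rfl | h
          · exact absurd hx has
          · exact .inl h
        · exact .inr h
    · rintro (⟨h1, h2⟩ | h)
      · exact ⟨fun x hx => (h1 x hx).imp_left (Finset.mem_insert_of_mem ·), h2⟩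
      · exact h.1
  · rintro s ⟨h1, -⟩ ⟨-, h⟩
    exact (h1 a h).elim haA haB

lemma countP_mem_insert {B : Finset ℕ} {b : ℕ} {s : Multiset ℕ} (hb : b ∉ s) :
    s.countP (· ∈ insert b B) = s.countP (· ∈ B) :=
  Multiset.countP_congr rfl fun x hx => by
    have : x ≠ b := by rintro rfl; exact hb hx
    simp [this]

lemma mem_letterSet_insert_right_iff {A B : Finset ℕ} {b : ℕ} {s : Multiset ℕ} (hb : b ∉ s)
    (i : ℕ) : s ∈ letterSet A (insert b B) i ↔ s ∈ letterSet A B i := by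
  refine and_congr (forall₂_congr fun x hx => ?_) (by rw [countP_mem_insert hb])
  have : x ≠ b := by rintro rfl; exact hb hx
  simp [this]

lemma gf_letterSet_insert_right_zero (A B : Finset ℕ) {b : ℕ} (hbA : b ∉ A) (hbB : b ∉ B) :
    gf (letterSet A (insert b B) 0) Multiset.sum = gf (letterSet A B 0) Multiset.sum := by
  refine gf_congr fun s => ?_
  by_cases hb : b ∈ s
  · refine iff_of_false (fun h => ?_) fun h => (h.1 b hb).elim hbA hbB
    exact Multiset.countP_eq_zero.1 h.2 b hb (Finset.mem_insert_self b B)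
  · exact mem_letterSet_insert_right_iff hb 0

/-- Adjoining a counted letter `b`: a multiset either avoids `b` or arises by adding one `b`, which
raises the count. -/
lemma gf_letterSet_insert_right_succ {A B : Finset ℕ} (hA : ∀ x ∈ A, 0 < x) (hB : ∀ x ∈ B, 0 < x)
    {b : ℕ} (hb : 0 < b) (hbA : b ∉ A) (hbB : b ∉ B) (i : ℕ) :
    gf (letterSet A (insert b B) (i + 1)) Multiset.sum =
      gf (letterSet A B (i + 1)) Multiset.sum +
        qvar ^ b * gf (letterSet A (insert b B) i) Multiset.sum := by
  have hmem := Finset.mem_insert_self b B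
  have hbij : Set.BijOn (fun s => b ::ₘ s) (letterSet A (insert b B) i)
      {s | s ∈ letterSet A (insert b B) (i + 1) ∧ b ∈ s} := by
    refine ⟨?_, fun s _ t _ h => (Multiset.cons_inj_right b).1 h, ?_⟩
    · rintro s ⟨h1, h2⟩
      refine ⟨⟨fun x hx => ?_, ?_⟩, Multiset.mem_cons_self b s⟩
      · rcases Multiset.mem_cons.1 hx with rfl | hx
        · exact .inr hmem
        · exact h1 x hx
      · rw [Multiset.countP_cons_of_pos _ hmem, h2]
    · rintro s ⟨⟨h1, h2⟩, h3⟩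
      obtain ⟨t, rfl⟩ := Multiset.exists_cons_of_mem h3
      rw [Multiset.countP_cons_of_pos _ hmem] at h2
      exact ⟨t, ⟨fun x hx => h1 x (Multiset.mem_cons_of_mem hx), Nat.succ.inj h2⟩, rfl⟩
  rw [← gf_bijOn _ b hbij (w' := Multiset.sum) fun s _ => Multiset.sum_cons b s]
  have hB' : ∀ x ∈ insert b B, 0 < x := by simpa [hb] using hB
  refine gf_add_of_disjoint ((finFibers_letters hA hB').mono fun s hs => hs.1) (fun s => ?_) ?_
  · by_cases hbs : b ∈ s
    · have : s ∉ letterSet A B (i + 1) := fun h => (h.1 b hbs).elim hbA hbB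
      exact ⟨fun h => .inr ⟨h, hbs⟩, fun h => h.elim (fun h => absurd h this) fun h => h.1⟩
    · rw [mem_letterSet_insert_right_iff hbs]
      exact ⟨fun h => .inl h, fun h => h.elim id fun h => absurd h.2 hbs⟩
  · rintro s ⟨h1, -⟩ ⟨-, h⟩
    exact (h1 b h).elim hbA hbB

/-- The arithmetic progression `{d, d + 2, …, d + 2(m - 1)}`. -/
def prog (d m : ℕ) : Finset ℕ := (Finset.range m).image fun i => d + 2 * i

lemma prog_succ (d m : ℕ) : prog d (m + 1) = insert (d + 2 * m) (prog d m) := by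
  rw [prog, Finset.range_add_one, Finset.image_insert, prog]

lemma mem_prog {d m x : ℕ} : x ∈ prog d m ↔ ∃ i < m, d + 2 * i = x := by simp [prog]

lemma gf_letterSet_prog {A : Finset ℕ} (hA : ∀ x ∈ A, 0 < x) {d m : ℕ} (hd : 0 < d)
    (h : ∀ x ∈ prog d m, x ∉ A) (i : ℕ) :
    gf (letterSet A (prog d m) i) Multiset.sum =
      progTerm qvar d m i * gf (letterSet A ∅ 0) Multiset.sum := by
  have hq := nontorsion_qvar
  have hpos : ∀ m, ∀ x ∈ prog d m, 0 < x := fun m x hx => by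
    obtain ⟨i, -, rfl⟩ := mem_prog.1 hx; omega
  induction m generalizing i with
  | zero =>
    cases i with
    | zero => rw [progTerm_zero_right, one_mul]; rfl
    | succ i =>
      rw [progTerm_zero_succ hq, zero_mul, ← gf_empty Multiset.sum]
      refine gf_congr fun s => iff_of_false (fun h => ?_) (Set.notMem_empty s)
      have h1 := h.2
      have h2 : s.countP (· ∈ prog d 0) = 0 := Multiset.countP_eq_zero.2 fun x _ => by simp [prog]
      omega
  | succ m ih =>
    rw [prog_succ] at h ⊢
    have hA1 : d + 2 * m ∉ A := h _ (Finset.mem_insert_self _ _)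
    have hB1 : d + 2 * m ∉ prog d m := fun h => by
      obtain ⟨i, hi, h⟩ := mem_prog.1 h; omega
    have ih' := ih fun x hx => h x (Finset.mem_insert_of_mem hx)
    induction i with
    | zero => rw [gf_letterSet_insert_right_zero A _ hA1 hB1, ih', progTerm_zero_right,
        progTerm_zero_right]
    | succ i ihi =>
      rw [gf_letterSet_insert_right_succ hA (hpos m) (by omega) hA1 hB1, ih', ihi,
        progTerm_succ hq]
      ring

lemma gf_letterSet_insert_left_empty {A : Finset ℕ} (hA : ∀ x ∈ A, 0 < x) {a : ℕ}
    (haA : 2 * a + 1 ∉ A) :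
    gf (letterSet (insert (2 * a + 1) A) ∅ 0) Multiset.sum =
      gf (letterSet A ∅ 0) Multiset.sum / (1 - qvar ^ (2 * a + 1)) := by
  rw [eq_div_iff (nontorsion_qvar.one_sub_pow_ne_zero _)]
  linear_combination gf_letterSet_insert_left hA (B := ∅) (by simp) (by omega) haA (by simp) 0

/-- The odd numbers `a < 2n` that are less than `2c` or greater than `2(n - g)`. -/
def freeOdds (n c g : ℕ) : Finset ℕ :=
  (Finset.range c ∪ Finset.Ico (n - g) n).image fun i => 2 * i + 1

lemma mem_freeOdds {n c g x : ℕ} :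
    x ∈ freeOdds n c g ↔ ∃ i, (i < c ∨ n - g ≤ i ∧ i < n) ∧ 2 * i + 1 = x := by
  simp [freeOdds]

lemma gf_letterSet_freeOdds {n c g : ℕ} (h : c + g ≤ n) :
    gf (letterSet (freeOdds n c g) ∅ 0) Multiset.sum = 1 / oddDenom qvar n c g := by
  have hq := nontorsion_qvar
  have hpos : ∀ c g, ∀ x ∈ freeOdds n c g, 0 < x := fun c g x hx => by
    obtain ⟨i, -, rfl⟩ := mem_freeOdds.1 hx; omega
  induction c with
  | zero =>
    induction g with
    | zero =>
      rw [gf_eq_one 0 (fun s => ?_) Multiset.sum_zero]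
      · simp [oddDenom]
      · constructor
        · intro hs
          refine Multiset.eq_zero_of_forall_notMem fun x hx => ?_
          simpa [freeOdds] using hs.1 x hx
        · rintro rfl; simp [letterSet]
    | succ g ih =>
      have e : freeOdds n 0 (g + 1) = insert (2 * (n - (g + 1)) + 1) (freeOdds n 0 g) := by
        ext x
        rw [Finset.mem_insert, mem_freeOdds, mem_freeOdds]
        constructor
        · rintro ⟨i, hi, rfl⟩
          by_cases hi' : i = n - (g + 1)
          · exact .inl (by rw [hi'])
          · exact .inr ⟨i, .inr (by omega), rfl⟩
        · rintro (rfl | ⟨i, hi, rfl⟩)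
          · exact ⟨_, .inr (by omega), rfl⟩
          · exact ⟨i, .inr (by omega), rfl⟩
      rw [e, gf_letterSet_insert_left_empty (hpos 0 g), ih (by omega),
        oddDenom_succ_right hq.ne_zero (show n = g + 1 + (n - (g + 1)) by omega), div_div]
      rw [mem_freeOdds]
      rintro ⟨i, hi, hi'⟩
      omega
  | succ c ih =>
    have e : freeOdds n (c + 1) g = insert (2 * c + 1) (freeOdds n c g) := by
      ext x
      rw [Finset.mem_insert, mem_freeOdds, mem_freeOdds]
      constructor
      · rintro ⟨i, hi, rfl⟩
        by_cases hi' : i = c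
        · exact .inl (by rw [hi'])
        · exact .inr ⟨i, by omega, rfl⟩
      · rintro (rfl | ⟨i, hi, rfl⟩)
        · exact ⟨_, .inl (by omega), rfl⟩
        · exact ⟨i, by omega, rfl⟩
    rw [e, gf_letterSet_insert_left_empty (hpos c g), ih (by omega), oddDenom_succ_left, div_div]
    rw [mem_freeOdds]
    rintro ⟨i, hi, hi'⟩
    omega

/-- The partitions into odd parts less than `2n`, fewer than `t` of which lie between `2c` and
`2(n - g)`. -/
def oddPartitions (n c g t : ℕ) : Set (Multiset ℕ) :=
  {s | (∀ x ∈ s, Odd x ∧ x < 2 * n) ∧ s.countP (fun x => 2 * c < x ∧ x < 2 * (n - g)) < t}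

lemma finFibers_oddPartitions (n c g t : ℕ) : FinFibers (oddPartitions n c g t) Multiset.sum :=
  finFibers_multiset fun _ hs x hx => (hs.1 x hx).1.pos

lemma gf_oddPartitions {n c m g : ℕ} (h : n = c + m + g) (t : ℕ) :
    gf (oddPartitions n c g t) Multiset.sum =
      (∑ i ∈ Finset.range t, progTerm qvar (2 * c + 1) m i) / oddDenom qvar n c g := by
  have hA : ∀ x ∈ freeOdds n c g, 0 < x := fun x hx => by
    obtain ⟨i, -, rfl⟩ := mem_freeOdds.1 hx; omega
  have hB : ∀ x ∈ prog (2 * c + 1) m, 0 < x := fun x hx => by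
    obtain ⟨i, -, rfl⟩ := mem_prog.1 hx; omega
  have hd : ∀ x ∈ prog (2 * c + 1) m, x ∉ freeOdds n c g := fun x hx hx' => by
    obtain ⟨i, hi, rfl⟩ := mem_prog.1 hx
    obtain ⟨j, hj, hij⟩ := mem_freeOdds.1 hx'
    omega
  have hiff : ∀ s, s ∈ oddPartitions n c g t ↔
      s ∈ {s | s ∈ {s : Multiset ℕ | ∀ x ∈ s, x ∈ freeOdds n c g ∨ x ∈ prog (2 * c + 1) m} ∧
        s.countP (· ∈ prog (2 * c + 1) m) < t} := fun s => by
    have h1 : (∀ x ∈ s, Odd x ∧ x < 2 * n) ↔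
        ∀ x ∈ s, x ∈ freeOdds n c g ∨ x ∈ prog (2 * c + 1) m := by
      refine forall₂_congr fun x _ => ?_
      rw [mem_freeOdds, mem_prog]
      constructor
      · rintro ⟨⟨i, rfl⟩, hi⟩
        by_cases hi' : i < c ∨ n - g ≤ i
        · exact .inl ⟨i, by omega, rfl⟩
        · exact .inr ⟨i - c, by omega, by omega⟩
      · rintro (⟨i, hi, rfl⟩ | ⟨i, hi, rfl⟩)
        · exact ⟨⟨i, rfl⟩, by omega⟩
        · exact ⟨⟨c + i, by omega⟩, by omega⟩
    have h2 : (∀ x ∈ s, Odd x ∧ x < 2 * n) →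
        s.countP (fun x => 2 * c < x ∧ x < 2 * (n - g)) =
          s.countP (· ∈ prog (2 * c + 1) m) := fun hs =>
      Multiset.countP_congr rfl fun x hx => by
        obtain ⟨i, rfl⟩ := (hs x hx).1
        rw [mem_prog, eq_iff_iff]
        constructor
        · exact fun hx => ⟨i - c, by omega, by omega⟩
        · rintro ⟨j, hj, hj'⟩; omega
    exact ⟨fun h => ⟨h1.1 h.1, (h2 h.1).symm.trans_lt h.2⟩,
      fun h => ⟨h1.2 h.1, (h2 (h1.2 h.1)).trans_lt h.2⟩⟩
  rw [gf_congr hiff, gf_eq_sum (finFibers_letters hA hB), Finset.sum_div]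
  refine Finset.sum_congr rfl fun i _ => ?_
  have := gf_letterSet_prog hA (by omega) hd i
  rw [gf_letterSet_freeOdds (by omega), mul_one_div] at this
  exact this

theorem genFun_inR {n k : ℕ} (hk : k ≤ n) :
    genFun (fun N => numPartitions (InR n k) N) = oddSum qvar n k := by
  rw [genFun_numPartitions, oddSum_eq hk,
    ← gf_oddPartitions (show n = (k + 1) / 2 + (n - k) + k / 2 by omega)]
  refine gf_congr fun s => ?_
  have hc : ∀ s : Multiset ℕ, (∀ x ∈ s, Odd x ∧ x < 2 * n) →
      s.countP (fun i => 2 * ((k + 1) / 2) + 1 ≤ i ∧ i ≤ 2 * (n - k / 2) - 1) =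
        s.countP (fun x => 2 * ((k + 1) / 2) < x ∧ x < 2 * (n - k / 2)) := fun s hs =>
    Multiset.countP_congr rfl fun x hx => by
      rw [eq_iff_iff]; omega
  constructor
  · rintro ⟨-, h1, h2⟩
    exact ⟨h1, by rw [← hc s h1]; omega⟩
  · rintro ⟨h1, h2⟩
    refine ⟨fun x hx => (h1 x hx).1.pos, h1, ?_⟩
    rw [hc s h1]; omega

/-- With `f = ⌊k/2⌋`, these are the partitions with at most `f` parts between `2⌈k/2⌉` and
`2(n - f)`, without those that have fewer than `f` parts between `2⌈k/2⌉` and `2(n - f + 1)`. -/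
lemma genFun_inRPos {n k : ℕ} (hk : k ≤ n) :
    genFun (fun N => numPartitions (InRPos n k) N) =
      progTerm qvar (2 * ((k + 1) / 2) + 1) (n - k + 1) (k / 2) /
        oddDenom qvar n ((k + 1) / 2) (k / 2) := by
  have hq := nontorsion_qvar
  rw [genFun_numPartitions]
  have e1 := gf_oddPartitions (show n = (k + 1) / 2 + (n - k) + k / 2 by omega) (k / 2 + 1)
  rw [sum_progTerm_top hq] at e1
  have hc : ∀ s : Multiset ℕ, (∀ x ∈ s, Odd x ∧ x < 2 * n) →
      s.countP (fun i => 2 * ((k + 1) / 2) + 1 ≤ i ∧ i < 2 * n - 2 * (k / 2) + 1) =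
        s.countP (fun x => 2 * ((k + 1) / 2) < x ∧ x < 2 * (n - k / 2)) := fun s hs =>
    Multiset.countP_congr rfl fun x hx => by
      obtain ⟨⟨i, rfl⟩, hi⟩ := hs x hx
      rw [eq_iff_iff]; omega
  obtain hf | ⟨f, hf⟩ : k / 2 = 0 ∨ ∃ f, k / 2 = f + 1 := by
    rcases k / 2 with _ | f
    · exact .inl rfl
    · exact .inr ⟨f, rfl⟩
  -- if `⌊k/2⌋ = 0` there is nothing to remove, and the distinguished part would be `2n + 1`
  · rw [hf] at e1 hc ⊢
    simp only [Finset.range_zero, Finset.sum_empty, mul_zero, zero_add] at e1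
    rw [← e1]
    refine gf_congr fun s => ?_
    constructor
    · rintro ⟨-, h1, -, h2⟩
      rw [hf, hc s h1] at h2
      exact ⟨h1, by omega⟩
    · rintro ⟨h1, h2⟩
      refine ⟨fun x hx => (h1 x hx).1.pos, h1, by omega, ?_⟩
      rw [hf, hc s h1]; omega
  · have e2 := gf_oddPartitions (show n = (k + 1) / 2 + (n - k + 1) + f by omega) (k / 2)
    have e3 := oddDenom_succ_right (q := qvar) hq.ne_zero
      (show n = f + 1 + (n - (f + 1)) by omega) ((k + 1) / 2)
    have hc' : ∀ s : Multiset ℕ, (∀ x ∈ s, Odd x ∧ x < 2 * n) →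
        s.countP (fun i => 2 * ((k + 1) / 2) + 1 ≤ i ∧ i ≤ 2 * n - 2 * (k / 2) + 1) =
          s.countP (fun x => 2 * ((k + 1) / 2) < x ∧ x < 2 * (n - f)) := fun s hs =>
      Multiset.countP_congr rfl fun x hx => by
        obtain ⟨⟨i, rfl⟩, hi⟩ := hs x hx
        rw [eq_iff_iff]; omega
    have e4 : gf (oddPartitions n ((k + 1) / 2) (k / 2) (k / 2 + 1)) Multiset.sum =
        gf {s | (∀ x ∈ s, 0 < x) ∧ InRPos n k s} Multiset.sum +
          gf (oddPartitions n ((k + 1) / 2) f (k / 2)) Multiset.sum := by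
      refine gf_add_of_disjoint (finFibers_oddPartitions _ _ _ _) (fun s => ?_) ?_
      · constructor
        · rintro ⟨h1, h2⟩
          by_cases h3 : s.countP (fun x => 2 * ((k + 1) / 2) < x ∧ x < 2 * (n - f)) < k / 2
          · exact .inr ⟨h1, h3⟩
          · refine .inl ⟨fun x hx => (h1 x hx).1.pos, h1, ?_, ?_⟩
            · rw [hc' s h1]; omega
            · rw [hc s h1]; omega
        · rintro (⟨-, h1, -, h2⟩ | ⟨h1, h2⟩)
          · rw [hc s h1] at h2
            exact ⟨h1, by omega⟩
          · refine ⟨h1, lt_of_le_of_lt ?_ (h2.trans (Nat.lt_succ_self _))⟩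
            -- the range in the second set contains the range in the first
            rw [Multiset.countP_eq_card_filter, Multiset.countP_eq_card_filter]
            refine Multiset.card_le_card (Multiset.monotone_filter_right s ?_)
            rintro x ⟨hx1, hx2⟩
            exact ⟨hx1, by omega⟩
      · rintro s ⟨-, h1, h2, -⟩ ⟨-, h3⟩
        rw [hc' s h1] at h2
        omega
    have e5 : 2 * ((k + 1) / 2) + 1 + 2 * (n - k) = 2 * (n - k / 2) + 1 := by omega
    rw [← hf] at e3
    rw [e1, e2, e5, ← sub_eq_iff_eq_add, e3] at e4
    rw [← e4, e3]
    have n1 := oddDenom_ne_zero hq (c := (k + 1) / 2) (show f ≤ n by omega)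
    have n2 := hq.one_sub_pow_ne_zero (2 * (n - k / 2))
    field_simp
    ring

lemma numPartitions_sub (P : Multiset ℕ → Prop) (N : ℕ) {a b : ℕ} (h : b ≤ a) :
    numPartitions P ((N : ℤ) - (a - b)) =
      if a - b ≤ N then numPartitions P ((N - (a - b) : ℕ) : ℤ) else 0 := by
  split_ifs with hN
  · congr 1; omega
  · rw [numPartitions, if_neg (by omega)]

theorem genFun_inRPos_shift {n k : ℕ} (hk : k ≤ n) :
    genFun (fun N => numPartitions (InRPos n k)
      ((N : ℤ) - (((k + 1) / 2 : ℕ) - (k / 2 : ℕ)))) = oddTerm qvar n k := by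
  simp only [numPartitions_sub _ _ (show k / 2 ≤ (k + 1) / 2 by omega)]
  rw [← qvar_pow_mul_genFun ((k + 1) / 2 - k / 2) fun N => numPartitions (InRPos n k) N,
    genFun_inRPos hk, oddTerm_eq hk, mul_div_assoc]

end Partitions

/-! ### Partitions into distinct parts -/

section Distinct

/-- The partitions into `m` distinct parts. -/
def distinctPartitions (m : ℕ) : Set (Multiset ℕ) :=
  {s | s ∈ {s : Multiset ℕ | (∀ x ∈ s, 0 < x) ∧ s.Nodup} ∧ s.card = m}

lemma finFibers_distinct :
    FinFibers {s : Multiset ℕ | (∀ x ∈ s, 0 < x) ∧ s.Nodup} Multiset.sum :=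
  finFibers_multiset fun _ hs => hs.1

lemma sum_map_succ (s : Multiset ℕ) : (s.map Nat.succ).sum = s.card + s.sum := by
  induction s using Multiset.induction_on with
  | empty => simp
  | cons a s ih => simp [ih]; ring

lemma exists_map_succ_eq {s : Multiset ℕ} (h : ∀ x ∈ s, 1 < x) :
    ∃ t : Multiset ℕ, (∀ x ∈ t, 0 < x) ∧ t.map Nat.succ = s := by
  refine ⟨s.map Nat.pred, ?_, ?_⟩
  · intro x hx
    obtain ⟨y, hy, rfl⟩ := Multiset.mem_map.1 hx
    have := h y hy
    simp only [Nat.pred_eq_sub_one]; omega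
  · rw [Multiset.map_map]
    conv_rhs => rw [← Multiset.map_id s]
    exact Multiset.map_congr rfl fun x hx => Nat.succ_pred_eq_of_pos (by have := h x hx; omega)

/-- Subtracting `1` from each part leaves `m + 1` or `m` positive parts. -/
lemma gf_distinctPartitions_succ (m : ℕ) :
    gf (distinctPartitions (m + 1)) Multiset.sum =
      qvar ^ (m + 1) * gf (distinctPartitions (m + 1)) Multiset.sum +
        qvar ^ (m + 1) * gf (distinctPartitions m) Multiset.sum := by
  have hinj : Function.Injective (Multiset.map Nat.succ) :=
    Multiset.map_injective Nat.succ_injective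
  have hb1 : Set.BijOn (Multiset.map Nat.succ) (distinctPartitions (m + 1))
      {s | s ∈ distinctPartitions (m + 1) ∧ 1 ∉ s} := by
    refine ⟨?_, hinj.injOn, ?_⟩
    · rintro s ⟨⟨h1, h2⟩, h3⟩
      refine ⟨⟨⟨fun x hx => ?_, (Multiset.nodup_map_iff_of_injective Nat.succ_injective).2 h2⟩,
        by rw [Multiset.card_map, h3]⟩, fun h => ?_⟩
      · obtain ⟨y, -, rfl⟩ := Multiset.mem_map.1 hx; omega
      · obtain ⟨y, hy, h⟩ := Multiset.mem_map.1 h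
        have := h1 y hy; omega
    · rintro s ⟨⟨⟨h1, h2⟩, h3⟩, h4⟩
      obtain ⟨t, ht, rfl⟩ := exists_map_succ_eq (s := s) fun x hx => by
        have := h1 x hx
        have : x ≠ 1 := by rintro rfl; exact h4 hx
        omega
      exact ⟨t, ⟨⟨ht, h2.of_map⟩, by rwa [Multiset.card_map] at h3⟩, rfl⟩
  have hb2 : Set.BijOn (fun s => 1 ::ₘ Multiset.map Nat.succ s) (distinctPartitions m)
      {s | s ∈ distinctPartitions (m + 1) ∧ 1 ∈ s} := by
    refine ⟨?_, fun s _ t _ h => hinj ((Multiset.cons_inj_right 1).1 h), ?_⟩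
    · rintro s ⟨⟨h1, h2⟩, h3⟩
      refine ⟨⟨⟨fun x hx => ?_, Multiset.nodup_cons.2 ⟨fun h => ?_,
        (Multiset.nodup_map_iff_of_injective Nat.succ_injective).2 h2⟩⟩,
        by rw [Multiset.card_cons, Multiset.card_map, h3]⟩, Multiset.mem_cons_self _ _⟩
      · rcases Multiset.mem_cons.1 hx with rfl | hx
        · exact one_pos
        · obtain ⟨y, -, rfl⟩ := Multiset.mem_map.1 hx; omega
      · obtain ⟨y, hy, h⟩ := Multiset.mem_map.1 h
        have := h1 y hy; omega
    · rintro s ⟨⟨⟨h1, h2⟩, h3⟩, h4⟩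
      obtain ⟨u, rfl⟩ := Multiset.exists_cons_of_mem h4
      obtain ⟨h5, h6⟩ := Multiset.nodup_cons.1 h2
      obtain ⟨t, ht, rfl⟩ := exists_map_succ_eq (s := u) fun x hx => by
        have := h1 x (Multiset.mem_cons_of_mem hx)
        have : x ≠ 1 := by rintro rfl; exact h5 hx
        omega
      exact ⟨t, ⟨⟨ht, h6.of_map⟩, by simpa using h3⟩, rfl⟩
  rw [← gf_bijOn _ (m + 1) hb1 (w' := Multiset.sum) fun s hs => by rw [sum_map_succ, hs.2],
    ← gf_bijOn _ (m + 1) hb2 (w' := Multiset.sum) fun s hs => by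
      rw [Multiset.sum_cons, sum_map_succ, hs.2]; ring]
  refine gf_add_of_disjoint (finFibers_distinct.mono fun s hs => hs.1) (fun s => ?_) ?_
  · by_cases h : 1 ∈ s <;> simp [h]
  · exact fun s hs hs' => hs.2 hs'.2

lemma gf_distinctPartitions (m : ℕ) :
    gf (distinctPartitions m) Multiset.sum = qvar ^ (m + 1).choose 2 / qPoch qvar qvar m := by
  have hq := nontorsion_qvar
  induction m with
  | zero =>
    rw [gf_eq_one 0 (fun s => ?_) Multiset.sum_zero]
    · simp
    · constructor
      · exact fun h => Multiset.card_eq_zero.1 h.2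
      · rintro rfl; simp [distinctPartitions]
  | succ m ih =>
    have h := gf_distinctPartitions_succ m
    rw [ih] at h
    have n1 := hq.qPoch_self_ne_zero m
    have n2 := hq.one_sub_pow_ne_zero m
    rw [qPoch_succ, ← pow_succ', eq_div_iff (mul_ne_zero n1 n2), Nat.choose_succ_succ' (m + 1) 1,
      Nat.choose_one_right, pow_add]
    field_simp at h
    linear_combination h

lemma genFun_distinct_card_eq (k : ℕ) :
    genFun (fun N => numPartitions (fun s => s.Nodup ∧ s.card = k) N) =
      qvar ^ (k + 1).choose 2 / qPoch qvar qvar k := by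
  rw [genFun_numPartitions, ← gf_distinctPartitions]
  exact gf_congr fun s => and_assoc.symm

lemma genFun_distinct_card_le (k : ℕ) :
    genFun (fun N => numPartitions (fun s => s.Nodup ∧ s.card ≤ k) N) =
      ∑ m ∈ Finset.range (k + 1), qvar ^ (m + 1).choose 2 / qPoch qvar qvar m := by
  rw [genFun_numPartitions]
  simp only [← gf_distinctPartitions]
  refine Eq.trans (gf_congr fun s => ?_) (gf_eq_sum finFibers_distinct Multiset.card (k + 1))
  simp only [Set.mem_ofPred_eq, and_assoc, Nat.lt_succ_iff]

end Distinct

/-! ### Limits as `n → ∞` -/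

section Limits

open Filter Topology

/-- The `q`-adic topology on `ℚ((q))` is finer than coefficientwise convergence in the discrete
topology. -/
lemma eventually_coeff_eq {f : ℕ → LaurentSeries ℚ} {g : LaurentSeries ℚ}
    (h : Tendsto f atTop (𝓝 g)) (N : ℤ) : ∀ᶠ n in atTop, (f n).coeff N = g.coeff N := by
  let _ : UniformSpace ℚ := ⊥
  have : DiscreteTopology ℚ := ⟨rfl⟩
  have hc := (LaurentSeries.uniformContinuous_coeff N).continuous.continuousAt.tendsto.comp h
  rw [nhds_discrete, tendsto_pure] at hc
  exact hc

lemma tendsto_qvar_pow : Tendsto (fun n : ℕ => qvar ^ n) atTop (𝓝 0) := by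
  refine Valued.tendsto_zero_pow_of_le_exp_neg_one ?_
  have := LaurentSeries.valuation_single_zpow ℚ 1
  exact this.le

lemma tendsto_qvar_zpow (c : ℤ) : Tendsto (fun n : ℕ => qvar ^ ((n : ℤ) + c)) atTop (𝓝 0) := by
  have := tendsto_qvar_pow.mul_const (qvar ^ c)
  rw [zero_mul] at this
  refine this.congr fun n => ?_
  rw [zpow_add₀ nontorsion_qvar.ne_zero, zpow_natCast]

lemma tendsto_qvar_zpow_two_mul (c : ℤ) :
    Tendsto (fun n : ℕ => qvar ^ (2 * (n : ℤ) + c)) atTop (𝓝 0) := by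
  have := tendsto_qvar_pow.mul (tendsto_qvar_zpow c)
  rw [zero_mul] at this
  refine this.congr fun n => ?_
  rw [← zpow_natCast, ← zpow_add₀ nontorsion_qvar.ne_zero]
  congr 1
  ring

lemma tendsto_qPoch_one {a : ℕ → LaurentSeries ℚ} (ha : Tendsto a atTop (𝓝 0))
    (p : LaurentSeries ℚ) (m : ℕ) : Tendsto (fun n => qPoch (a n) p m) atTop (𝓝 1) := by
  have : Tendsto (fun n => ∏ i ∈ Finset.range m, (1 - a n * p ^ i)) atTop
      (𝓝 (∏ i ∈ Finset.range m, (1 - 0 * p ^ i))) :=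
    tendsto_finsetProd _ fun i _ => tendsto_const_nhds.sub (ha.mul_const _)
  simp only [zero_mul, sub_zero, Finset.prod_const_one] at this
  exact this

lemma tendsto_hallTerm (m : ℕ) :
    Tendsto (fun n => hallTerm qvar n m) atTop
      (𝓝 (qvar ^ (m + 1).choose 2 / qPoch qvar qvar m)) := by
  have h1 := tendsto_qPoch_one (tendsto_qvar_zpow (-m + 1)) qvar m
  have h2 := tendsto_qPoch_one (a := fun n => -qvar ^ ((n : ℤ) + (-m + 1)))
    (by simpa using (tendsto_qvar_zpow (-m + 1)).neg) qvar m
  have h3 := tendsto_qPoch_one (tendsto_qvar_zpow_two_mul (-m + 1)) qvar m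
  have h := ((h1.div_const (qPoch qvar qvar m)).const_mul (qvar ^ (m + 1).choose 2)).mul
    (h2.div h3 one_ne_zero)
  rw [div_one, mul_one, mul_one_div] at h
  refine h.congr fun n => ?_
  rw [hallTerm, gauss, sub_add, sub_add, sub_eq_add_neg (n : ℤ), sub_eq_add_neg (2 * (n : ℤ)),
    neg_sub, sub_eq_neg_add 1 (m : ℤ)]
  rfl

lemma tendsto_gauss_sq (c : ℤ) (i : ℕ) :
    Tendsto (fun n : ℕ => gauss (qvar ^ 2) ((n : ℤ) + c) i) atTop
      (𝓝 (1 / qPoch (qvar ^ 2) (qvar ^ 2) i)) := by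
  have h := (tendsto_qPoch_one (tendsto_qvar_zpow_two_mul (2 * (c - i + 1))) (qvar ^ 2) i).div_const
    (qPoch (qvar ^ 2) (qvar ^ 2) i)
  refine h.congr fun n => ?_
  rw [gauss, ← zpow_natCast qvar 2, ← zpow_mul]
  congr 4
  push_cast
  ring

lemma tendsto_denom (c f : ℕ) :
    Tendsto (fun n : ℕ => qPoch qvar (qvar ^ 2) c *
      qPoch (qvar ^ (2 * (n : ℤ) - 1)) (qvar ^ (-2 : ℤ)) f) atTop
        (𝓝 (qPoch qvar (qvar ^ 2) c)) := by
  have := (tendsto_qPoch_one (tendsto_qvar_zpow_two_mul (-1)) (qvar ^ (-2 : ℤ)) f).const_mul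
    (qPoch qvar (qvar ^ 2) c)
  rwa [mul_one] at this

lemma qPoch_qvar_sq_ne_zero (c : ℕ) : qPoch qvar (qvar ^ 2) c ≠ 0 :=
  qPoch_ne_zero fun i _ => by
    rw [← pow_mul, ← pow_succ']
    exact nontorsion_qvar.pow_ne_one _ (Nat.succ_pos _)

lemma tendsto_oddSum (k : ℕ) :
    Tendsto (fun n => oddSum qvar n k) atTop
      (𝓝 (∑ i ∈ Finset.range (k / 2 + 1), qvar ^ (i * (2 * ((k + 1) / 2) + 1)) /
        (qPoch qvar (qvar ^ 2) ((k + 1) / 2) * qPoch (qvar ^ 2) (qvar ^ 2) i))) := by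
  refine tendsto_finsetSum _ fun i _ => ?_
  have h := ((tendsto_gauss_sq (-k - 1 + i) i).const_mul
    (qvar ^ (i * (2 * ((k + 1) / 2) + 1)))).div (tendsto_denom ((k + 1) / 2) (k / 2))
      (qPoch_qvar_sq_ne_zero _)
  rw [mul_one_div, div_div, mul_comm (qPoch _ _ i)] at h
  refine h.congr fun n => ?_
  rw [show (n : ℤ) - k - 1 + i = n + (-k - 1 + i) by ring]
  rfl

lemma tendsto_oddTerm (k : ℕ) :
    Tendsto (fun n => oddTerm qvar n k) atTop
      (𝓝 (qvar ^ (k + 1).choose 2 / (qPoch qvar (qvar ^ 2) ((k + 1) / 2) *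
        qPoch (qvar ^ 2) (qvar ^ 2) (k / 2)))) := by
  have h := ((tendsto_gauss_sq (-((k + 1) / 2 : ℕ)) (k / 2)).const_mul
    (qvar ^ (k + 1).choose 2)).div (tendsto_denom ((k + 1) / 2) (k / 2))
      (qPoch_qvar_sq_ne_zero _)
  rw [mul_one_div, div_div, mul_comm (qPoch _ _ (k / 2))] at h
  exact h

theorem sum_limit_identity (k : ℕ) :
    ∑ m ∈ Finset.range (k + 1), qvar ^ (m + 1).choose 2 / qPoch qvar qvar m =
      ∑ i ∈ Finset.range (k / 2 + 1), qvar ^ (i * (2 * ((k + 1) / 2) + 1)) /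
        (qPoch qvar (qvar ^ 2) ((k + 1) / 2) * qPoch (qvar ^ 2) (qvar ^ 2) i) :=
  tendsto_nhds_unique_of_eventuallyEq (tendsto_finsetSum _ fun m _ => tendsto_hallTerm m)
    (tendsto_oddSum k) <| (eventually_ge_atTop k).mono fun _ hn =>
      sum_hallTerm_eq_oddSum nontorsion_qvar hn

theorem limit_identity (k : ℕ) :
    qvar ^ (k + 1).choose 2 / qPoch qvar qvar k =
      qvar ^ (k + 1).choose 2 / (qPoch qvar (qvar ^ 2) ((k + 1) / 2) *
        qPoch (qvar ^ 2) (qvar ^ 2) (k / 2)) := by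
  rw [qPoch_even_odd qvar qvar, ← pow_two]

end Limits

/-! ### Refinements of Euler's theorem -/

section Refinements

open Filter

/-- For large `n` the bounds on the parts in `R_{n,k}` are vacuous for partitions of `N`. -/
theorem numPartitions_distinct_card_le (k N : ℕ) :
    numPartitions (fun s => s.Nodup ∧ s.card ≤ k) N =
      numPartitions (fun s => (∀ i ∈ s, Odd i) ∧
        s.countP (fun i => 2 * ((k + 1) / 2) + 1 ≤ i) ≤ k / 2) N := by
  obtain ⟨n, hn, hle⟩ := ((eventually_coeff_eq (tendsto_oddSum k) N).and
    (eventually_ge_atTop (N + k + 1))).exists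
  rw [← sum_limit_identity, ← genFun_distinct_card_le, ← genFun_inR (by omega), coeff_genFun,
    coeff_genFun, Nat.cast_inj] at hn
  rw [← hn]
  refine numPartitions_congr fun s hs => ?_
  have hc : s.countP (fun i => 2 * ((k + 1) / 2) + 1 ≤ i ∧ i ≤ 2 * (n - k / 2) - 1) =
      s.countP (fun i => 2 * ((k + 1) / 2) + 1 ≤ i) :=
    Multiset.countP_congr rfl fun x hx => by
      have := (hs x hx).2
      rw [eq_iff_iff]; omega
  rw [InR, hc]
  refine and_congr_left' (forall₂_congr fun x hx => and_iff_left ?_)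
  have := (hs x hx).2
  omega

theorem numPartitions_distinct_card_eq (k N : ℕ) :
    numPartitions (fun s => s.Nodup ∧ s.card = k) N =
      numPartitions (fun s => (∀ i ∈ s, Odd i) ∧
        s.countP (fun i => 2 * ((k + 1) / 2) + 1 ≤ i) = k / 2)
        ((N : ℤ) - (((k + 1) / 2 : ℕ) - (k / 2 : ℕ))) := by
  obtain ⟨n, hn, hle⟩ := ((eventually_coeff_eq (tendsto_oddTerm k) N).and
    (eventually_ge_atTop (N + k + 1))).exists
  rw [← limit_identity, ← genFun_distinct_card_eq, ← genFun_inRPos_shift (by omega), coeff_genFun,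
    coeff_genFun, Nat.cast_inj] at hn
  rw [← hn]
  refine numPartitions_congr fun s hs => ?_
  have hc : s.countP (fun i => 2 * ((k + 1) / 2) + 1 ≤ i ∧ i ≤ 2 * n - 2 * (k / 2) + 1) =
      s.countP (fun i => 2 * ((k + 1) / 2) + 1 ≤ i) :=
    Multiset.countP_congr rfl fun x hx => by
      have := (hs x hx).2
      rw [eq_iff_iff]; omega
  have hc' : s.countP (fun i => 2 * ((k + 1) / 2) + 1 ≤ i ∧ i < 2 * n - 2 * (k / 2) + 1) =
      s.countP (fun i => 2 * ((k + 1) / 2) + 1 ≤ i) :=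
    Multiset.countP_congr rfl fun x hx => by
      have := (hs x hx).2
      rw [eq_iff_iff]; omega
  rw [InRPos, hc, hc', eq_comm, ← le_antisymm_iff, eq_comm]
  refine and_congr_left' (forall₂_congr fun x hx => and_iff_left ?_)
  have := (hs x hx).2
  omega

end Refinements

end LectureHall

theorem mainTheorem6 :
    -- the first identity; its sides are the generating functions of `L_{n,k}` and `R_{n,k}`
    (∀ n k : ℕ, k ≤ n →
      ∑ m ∈ Finset.range (k + 1), hallTerm qvar n m = oddSum qvar n k ∧
      genFun (numOfWeight (truncatedHall n k)) =
        ∑ m ∈ Finset.range (k + 1), hallTerm qvar n m ∧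
      genFun (fun N => numPartitions (InR n k) N) = oddSum qvar n k ∧
      ∀ N : ℕ, numOfWeight (truncatedHall n k) N = numPartitions (InR n k) N) ∧
    -- its coefficientwise limit as `n → ∞`
    (∀ k : ℕ,
      (∀ N : ℤ, ∀ᶠ n : ℕ in Filter.atTop,
        (∑ m ∈ Finset.range (k + 1), hallTerm qvar n m).coeff N =
          (∑ m ∈ Finset.range (k + 1), qvar ^ (m + 1).choose 2 / qPoch qvar qvar m).coeff N) ∧
      (∀ N : ℤ, ∀ᶠ n : ℕ in Filter.atTop,
        (oddSum qvar n k).coeff N =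
          (∑ i ∈ Finset.range (k / 2 + 1), qvar ^ (i * (2 * ((k + 1) / 2) + 1)) /
            (qPoch qvar (qvar ^ 2) ((k + 1) / 2) * qPoch (qvar ^ 2) (qvar ^ 2) i)).coeff N) ∧
      ∑ m ∈ Finset.range (k + 1), qvar ^ (m + 1).choose 2 / qPoch qvar qvar m =
        ∑ i ∈ Finset.range (k / 2 + 1), qvar ^ (i * (2 * ((k + 1) / 2) + 1)) /
          (qPoch qvar (qvar ^ 2) ((k + 1) / 2) * qPoch (qvar ^ 2) (qvar ^ 2) i)) ∧
    -- at most `k` distinct parts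
    (∀ k N : ℕ,
      numPartitions (fun s => s.Nodup ∧ s.card ≤ k) N =
        numPartitions (fun s => (∀ i ∈ s, Odd i) ∧
          s.countP (fun i => 2 * ((k + 1) / 2) + 1 ≤ i) ≤ k / 2) N) ∧
    -- the second identity; its sides are the generating function of the elements of `L_{n,k}`
    -- with `k` positive parts
    (∀ n k : ℕ, k ≤ n →
      hallTerm qvar n k = oddTerm qvar n k ∧
      genFun (numOfWeight (positiveHall n k)) = hallTerm qvar n k ∧
      ∀ N : ℕ, numOfWeight (positiveHall n k) N =
        numPartitions (InRPos n k) ((N : ℤ) - (((k + 1) / 2 : ℕ) - (k / 2 : ℕ)))) ∧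
    -- its coefficientwise limit as `n → ∞`
    (∀ k : ℕ,
      (∀ N : ℤ, ∀ᶠ n : ℕ in Filter.atTop,
        (hallTerm qvar n k).coeff N =
          (qvar ^ (k + 1).choose 2 / qPoch qvar qvar k).coeff N) ∧
      (∀ N : ℤ, ∀ᶠ n : ℕ in Filter.atTop,
        (oddTerm qvar n k).coeff N =
          (qvar ^ (k + 1).choose 2 / (qPoch qvar (qvar ^ 2) ((k + 1) / 2) *
            qPoch (qvar ^ 2) (qvar ^ 2) (k / 2))).coeff N) ∧
      qvar ^ (k + 1).choose 2 / qPoch qvar qvar k =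
        qvar ^ (k + 1).choose 2 / (qPoch qvar (qvar ^ 2) ((k + 1) / 2) *
          qPoch (qvar ^ 2) (qvar ^ 2) (k / 2))) ∧
    -- exactly `k` distinct parts
    (∀ k N : ℕ,
      numPartitions (fun s => s.Nodup ∧ s.card = k) N =
        numPartitions (fun s => (∀ i ∈ s, Odd i) ∧
          s.countP (fun i => 2 * ((k + 1) / 2) + 1 ≤ i) = k / 2)
          ((N : ℤ) - (((k + 1) / 2 : ℕ) - (k / 2 : ℕ)))) := by
  have hq := nontorsion_qvar
  refine ⟨fun n k hk => ?_, fun k => ⟨fun N => ?_, fun N => ?_, sum_limit_identity k⟩,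
    numPartitions_distinct_card_le, fun n k hk => ?_,
    fun k => ⟨fun N => ?_, fun N => ?_, limit_identity k⟩, numPartitions_distinct_card_eq⟩
  · have h := sum_hallTerm_eq_oddSum hq hk
    exact ⟨h, genFun_truncatedHall hk, genFun_inR hk, congrFun <| genFun_injective <|
      (genFun_truncatedHall hk).trans (h.trans (genFun_inR hk).symm)⟩
  · exact eventually_coeff_eq (tendsto_finsetSum _ fun m _ => tendsto_hallTerm m) N
  · exact eventually_coeff_eq (tendsto_oddSum k) N
  · have h := hallTerm_eq_oddTerm hq hk
    exact ⟨h, genFun_positiveHall hk, congrFun <| genFun_injective <|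
      (genFun_positiveHall hk).trans (h.trans (genFun_inRPos_shift hk).symm)⟩
  · exact eventually_coeff_eq (tendsto_hallTerm k) N
  · exact eventually_coeff_eq (tendsto_oddTerm k) N
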